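/- Let $p$ be any prime number ($p=2$ is allowed) and let $F$ be a number field with a fixed algebraic closure $\overline F$. For an abelian group $M$, written multiplicatively, put $\widehat M=\varprojlim_n M/M^{p^n}$. Let $\mathcal F_\infty=F(\mu_{p^\infty})\subset\overline F$. For $\bar x=(\bar x_n)_n\in\widehat{F^*}$ let $F_{\bar x}\subset\overline F$ be the extension of $\mathcal F_\infty$ obtained by adjoining, for all $n$, the $p^n$-th roots of lifts $x_n\in F^*$ of $\bar x_n\in F^*/(F^*)^{p^n}$. For a prime (finite place) $\mathfrak q$ of $F$, let $F_{\mathfrak q}$ be the completion of $F$ at $\mathfrak q$, let $\mathrm{loc}_{\mathfrak q}:\widehat{F^*}\to\widehat{F_{\mathfrak q}^*}$ be the map induced by $F\subset F_{\mathfrak q}$, let $v_{\mathfrak q}:\widehat{F_{\mathfrak q}^*}\to\mathbb Z_p$ be the map induced by the normalized valuation $F_{\mathfrak q}^*\to\mathbb Z$, and write $v_{\mathfrak q}(\bar x)=v_{\mathfrak q}(\mathrm{loc}_{\mathfrak q}(\bar x))$ for $\bar x\in\widehat{F^*}$. The extension $F_{\bar x}/\mathcal F_\infty$ is called unramified at the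 primes above $\mathfrak q$ if the inertia subgroups of $\mathrm{Gal}(F_{\bar x}/\mathcal F_\infty)$ at all primes above $\mathfrak q$ are trivial. For a finite set $Q$ of primes of $F$, let $E_Q$ be the group of $x\in F^*$ with $v_{\mathfrak q}(x)=0$ for all $\mathfrak q\notin Q$; the natural map $\widehat{E_Q}\to\widehat{F^*}$ is injective, and $\widehat{E_Q}$ is identified with its image. 1. (Ramification criterion.) Let $\bar x\in\widehat{F^*}$ be non-torsion and let $\mathfrak q$ be a prime of $F$. Then $F_{\bar x}/\mathcal F_\infty$ is unramified at the primes above $\mathfrak q$ if and only if $\mathrm{loc}_{\mathfrak q}(\bar x)$ is torsion. 2. Let $Q$ be a finite set of primes of $F$ and let $\bar x\in\widehat{F^*}$. a) $\bar x\in\widehat{E_Q}$ if and only if $v_{\mathfrak q}(\bar x)=0$ for all $\mathfrak q\notin Q$. b) Suppose that $\bar x$ is non-torsion. If $F_{\bar x}/\mathcal F_\infty$ is unramified at the primes above every $\mathfrak q\notin Q$, then $\bar x\in\widehat{E_Q}$. Conversely, if $Q$ contains all the primes of $F$ above $p$ and $\bar x\in\widehat{E_Q}$, then $F_{\bar x}/\mathcal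 F_\infty$ is unramified at the primes above every $\mathfrak q\notin Q$. -/

import Mathlib

noncomputable section

namespace KummerZp

open IsDedekindDomain NumberField

/-! ### The `p`-adic completion of a multiplicative abelian group -/

/-- The `p`-adic completion `lim_n M / M ^ (p ^ n)` of a multiplicative abelian group `M`.
It is Mathlib's adic completion of the `ℤ`-module `Additive M` at the ideal `(p)` of `ℤ`, and is
therefore written additively. -/
abbrev PCompletion (p : ℕ) (M : Type*) [CommGroup M] : Type _ :=
  AdicCompletion (Ideal.span {(p : ℤ)}) (Additive M)

/-- The canonical map `M → lim_n M / M ^ (p ^ n)`. -/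
def toPCompletion (p : ℕ) (M : Type*) [CommGroup M] : Additive M →+ PCompletion p M :=
  (AdicCompletion.of (Ideal.span {(p : ℤ)}) (Additive M)).toAddMonoidHom

/-- The map of `p`-adic completions induced by a homomorphism of groups. -/
def PCompletion.map (p : ℕ) {M N : Type*} [CommGroup M] [CommGroup N] (f : M →* N) :
    PCompletion p M →+ PCompletion p N :=
  (AdicCompletion.map (Ideal.span {(p : ℤ)}) f.toAdditive.toIntLinearMap).toAddMonoidHom

theorem mem_span_pow_smul_top {A : Type*} [AddCommGroup A] (p n : ℕ) (a : A) :
    a ∈ (Ideal.span {(p : ℤ)} ^ n • ⊤ : Submodule ℤ A) ↔ ∃ b : A, a = p ^ n • b := by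
  rw [Ideal.span_singleton_pow, Submodule.ideal_span_singleton_smul,
    Submodule.mem_smul_pointwise_iff_exists]
  constructor
  · rintro ⟨b, -, rfl⟩
    exact ⟨b, by rw [← natCast_zsmul]; push_cast; rfl⟩
  · rintro ⟨b, rfl⟩
    exact ⟨b, trivial, by rw [← natCast_zsmul]; push_cast; rfl⟩

/-- `IsLiftAt p x n a` says that `a` is a lift to `M` of the component `x_n ∈ M / M ^ (p ^ n)` of
`x = (x_n)_n` in the `p`-adic completion of `M`. -/
def IsLiftAt (p : ℕ) {M : Type*} [CommGroup M] (x : PCompletion p M) (n : ℕ) (a : M) : Prop :=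
  AdicCompletion.eval (Ideal.span {(p : ℤ)}) (Additive M) n x =
    Submodule.Quotient.mk (Additive.ofMul a)

/-! ### `ℤ_p`-valued homomorphisms on the completion -/

/-- `ℤ_p` is `p`-adically complete as a `ℤ`-module. -/
instance isAdicComplete_padicInt (p : ℕ) [Fact p.Prime] :
    IsAdicComplete (Ideal.span {(p : ℤ)}) ℤ_[p] := by
  rw [← IsAdicComplete.map_algebraMap_iff (S := ℤ_[p])]
  have h : (Ideal.span {(p : ℤ)}).map (algebraMap ℤ ℤ_[p]) = IsLocalRing.maximalIdeal ℤ_[p] := by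
    rw [PadicInt.maximalIdeal_eq_span_p, Ideal.map_span]
    simp
  rw [h]
  infer_instance

/-- The homomorphism `lim_n M / M ^ (p ^ n) → ℤ_p = lim_n ℤ / p ^ n` induced by a homomorphism
`v : M → ℤ`. -/
def PCompletion.extend (p : ℕ) [Fact p.Prime] {M : Type*} [CommGroup M] (v : Additive M →+ ℤ) :
    PCompletion p M →+ ℤ_[p] :=
  ((AdicCompletion.ofLinearEquiv (Ideal.span {(p : ℤ)}) ℤ_[p]).symm.toLinearMap ∘ₗ
    AdicCompletion.map (Ideal.span {(p : ℤ)})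
      ((Int.castAddHom ℤ_[p]).comp v).toIntLinearMap).toAddMonoidHom

theorem PCompletion.extend_of (p : ℕ) [Fact p.Prime] {M : Type*} [CommGroup M]
    (v : Additive M →+ ℤ) (a : M) :
    PCompletion.extend p v (toPCompletion p M (Additive.ofMul a)) = v (Additive.ofMul a) := by
  change (AdicCompletion.ofLinearEquiv (Ideal.span {(p : ℤ)}) ℤ_[p]).symm
    (AdicCompletion.map _ _ (AdicCompletion.of _ _ _)) = _
  rw [AdicCompletion.map_of, AdicCompletion.ofLinearEquiv_symm_of]
  rfl

/-! ### Completions of a number field: `v_q` and `loc_q` -/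

section Local

variable {F : Type*} [Field F] [NumberField F]

/-- The normalized additive valuation `v_q : F_q^* → ℤ` of the completion `F_q`. -/
def localVal (q : HeightOneSpectrum (𝓞 F)) : Additive (q.adicCompletion F)ˣ →+ ℤ :=
  -(MonoidHom.toAdditiveLeft
    ((WithZero.unitsWithZeroEquiv (α := Multiplicative ℤ)).toMonoidHom.comp
      (Units.map (Valued.v (R := q.adicCompletion F)).toMonoidHom)))

theorem valued_eq_exp_localVal (q : HeightOneSpectrum (𝓞 F)) (y : (q.adicCompletion F)ˣ) :
    Valued.v (y : q.adicCompletion F) = WithZero.exp (-localVal q (Additive.ofMul y)) := by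
  have h : -localVal q (Additive.ofMul y) = Multiplicative.toAdd (WithZero.unitsWithZeroEquiv
      (Units.map (Valued.v (R := q.adicCompletion F)).toMonoidHom y)) := neg_neg _
  rw [h]
  exact (WithZero.coe_unitsWithZeroEquiv_eq_units_val
    (Units.map (Valued.v (R := q.adicCompletion F)).toMonoidHom y)).symm

/-- `loc_q`, the map from the completion of `F^*` to that of `F_q^*` induced by `F ⊆ F_q`. -/
def loc (p : ℕ) (q : HeightOneSpectrum (𝓞 F)) :
    PCompletion p Fˣ →+ PCompletion p (q.adicCompletion F)ˣ :=
  PCompletion.map p (Units.map (algebraMap F (q.adicCompletion F)).toMonoidHom)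

/-- The valuation `v_q` on the completion of `F^*`, with values in `ℤ_p`. -/
def completedVal (p : ℕ) [Fact p.Prime] (q : HeightOneSpectrum (𝓞 F)) :
    PCompletion p Fˣ →+ ℤ_[p] :=
  (PCompletion.extend p (localVal q)).comp (loc p q)

/-- The group `E_Q` of `Q`-units of `F`: the `x ∈ F^*` with `v_q(x) = 0` for all `q ∉ Q`. -/
abbrev qUnits (Q : Finset (HeightOneSpectrum (𝓞 F))) : Subgroup Fˣ :=
  (Q : Set (HeightOneSpectrum (𝓞 F))).unit F

/-- The natural map from the completion of `E_Q` to the completion of `F^*`. -/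
def qUnitsMap (p : ℕ) (Q : Finset (HeightOneSpectrum (𝓞 F))) :
    PCompletion p (qUnits Q) →+ PCompletion p Fˣ :=
  PCompletion.map p (qUnits Q).subtype

/-- The completion of `E_Q`, identified with its image in the completion of `F^*`. -/
def completedQUnits (p : ℕ) (Q : Finset (HeightOneSpectrum (𝓞 F))) :
    AddSubgroup (PCompletion p Fˣ) :=
  (qUnitsMap p Q).range

/-- The completion of `E_Q` injects into that of `F^*`, so that the identification above is
legitimate. -/
theorem qUnitsMap_injective (p : ℕ) [Fact p.Prime] (Q : Finset (HeightOneSpectrum (𝓞 F))) :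
    Function.Injective (qUnitsMap (F := F) p Q) := by
  rw [injective_iff_map_eq_zero]
  intro x hx
  refine AdicCompletion.ext fun n => ?_
  obtain ⟨e, he⟩ := Submodule.Quotient.mk_surjective _ (x.val n)
  have h1 : (qUnitsMap (F := F) p Q x).val n = 0 := by rw [hx]; rfl
  have h2 : (qUnitsMap (F := F) p Q x).val n =
      Submodule.Quotient.mk (Additive.ofMul ((e.toMul : qUnits Q) : Fˣ)) := by
    change (AdicCompletion.map _ _ x).val n = _
    rw [AdicCompletion.map_val_apply, ← he]
    rfl
  rw [h2, Submodule.Quotient.mk_eq_zero, mem_span_pow_smul_top] at h1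
  obtain ⟨b, hb⟩ := h1
  have hb' : ((e.toMul : qUnits Q) : Fˣ) = b.toMul ^ p ^ n := hb
  have hmem : b.toMul ∈ qUnits Q := by
    intro v hv
    have h3 := (e.toMul : qUnits Q).2 v hv
    rw [hb', Units.val_pow_eq_pow_val, map_pow] at h3
    exact (pow_eq_one_iff_of_nonneg zero_le (pow_ne_zero n (Fact.out : p.Prime).ne_zero)).mp h3
  rw [← he, AdicCompletion.val_zero_apply, Submodule.Quotient.mk_eq_zero, mem_span_pow_smul_top]
  exact ⟨Additive.ofMul ⟨b.toMul, hmem⟩, Subtype.ext hb'⟩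

end Local

/-! ### The fields `F(μ_{p^∞})` and `F_x` -/

/-- `F(μ_{p^∞})` inside the algebraic closure of `F`. -/
def cyclotomicTower (p : ℕ) (F : Type*) [Field F] : IntermediateField F (AlgebraicClosure F) :=
  IntermediateField.adjoin F {ζ | ∃ n : ℕ, ζ ^ p ^ n = 1}

/-- For `x = (x_n)_n` in the completion of `F^*`, the extension `F_x` of `F(μ_{p^∞})`
obtained by adjoining, for every `n`, the `p^n`-th roots of the lifts of `x_n` to `F^*`. -/
def kummerExtension (p : ℕ) {F : Type*} [Field F] (x : PCompletion p Fˣ) :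
    IntermediateField (cyclotomicTower p F) (AlgebraicClosure F) :=
  IntermediateField.adjoin (cyclotomicTower p F)
    {y | ∃ (n : ℕ) (a : Fˣ), IsLiftAt p x n a ∧
      y ^ p ^ n = algebraMap F (AlgebraicClosure F) a}

/-! ### Ramification in algebraic, possibly infinite, Galois extensions -/

/-- Let `F ⊆ K ⊆ L` be algebraic extensions of `ℚ`, with `L / K` Galois, and let `q` be a finite
prime of `F`. Then `L / K` is unramified at the primes above `q` if the inertia subgroup
of `Gal(L / K)` at every prime `P` of `L` above `q` is trivial. -/
def UnramifiedAbove {F : Type*} (K L : Type*) [Field F] [Field K] [Field L] [Algebra F L]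
    [Algebra K L] (q : HeightOneSpectrum (𝓞 F)) : Prop :=
  ∀ P : Ideal (𝓞 L), P.IsPrime → P.comap (algebraMap (𝓞 F) (𝓞 L)) = q.asIdeal →
    P.inertia (L ≃ₐ[K] L) = ⊥

end KummerZp

end

noncomputable section

namespace KummerZp

open IsDedekindDomain NumberField

/-! ### Roots of unity and powers -/

/-! The ramification criterion is proved without class field theory, by explicit work with radicals.

Suppose first that the extension is unramified above `q`. Embed the algebraic closure of `F` into
that of `F_q`. Any two elements of the decomposition group commute on the residue field and on
`F(μ_{p^∞})`, since both actions are governed by roots of unity (`map_comm_of_pow_eq_one`). Their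
commutator therefore lies in inertia over `F(μ_{p^∞})`, hence is trivial on `F_x`
(`map_map_eq_of_unramifiedAbove`). As `F_q` has only finitely many `p`-power roots of unity, some
`τ` moves a `p^r`-th one. Say `τ` raises `p^n`-th roots of unity to the power `c + 1`, and let `Y ^
p^n = a`. Commutation makes `Y^(c+1) / τ Y` Galois-invariant, so `a^c` is a `p^n`-th power in `F_q`.
Since `gcd(c, p^n)` divides `p^r`, so is `a^(p^r)`, with `r` independent of `n`: this is torsion.

Conversely, if a power of a radical is locally an `N`-th power up to roots of unity, density of `F`
in `F_q` makes it, after division by an element of `F` and a root of unity, very close to `1`.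
Inertia then multiplies it by a `p`-power root of unity nearer to `1` than `p` is to `0`, and such a
root is `1` (`eq_one_of_valuation_sub_one_lt`, `map_pow_eq_self_of_eq_pow`).

Part 2a follows from finiteness of the class group (`exists_mem_qUnits_isLiftAt`). In 2b, the first
implication holds because `ℤ_p` is torsion-free, so a torsion localization has valuation `0`. The
second uses that `p` is a unit at `q`, so congruence to `1` already forces a `p`-power root of unity
to be `1`. -/

theorem map_comm_of_pow_eq_one {R : Type*} [CommRing R] [IsDomain R] {b : R} {m : ℕ}
    (hm : m ≠ 0) (hb : b ^ m = 1) (σ τ : R →* R) : σ (τ b) = τ (σ b) := by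
  have hfin : IsOfFinOrder b := isOfFinOrder_iff_pow_eq_one.2 ⟨m, Nat.pos_of_ne_zero hm, hb⟩
  have hprim := IsPrimitiveRoot.orderOf b
  have : NeZero (orderOf b) := ⟨hfin.orderOf_pos.ne'⟩
  have key : ∀ f : R →* R, ∃ i, b ^ i = f b := fun f => by
    obtain ⟨i, -, hi⟩ := hprim.eq_pow_of_pow_eq_one (ξ := f b)
      (by rw [← map_pow, pow_orderOf_eq_one, map_one])
    exact ⟨i, hi⟩
  obtain ⟨i, hi⟩ := key σ
  obtain ⟨j, hj⟩ := key τ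
  rw [← hi, ← hj, map_pow, map_pow, ← hi, ← hj, ← pow_mul, ← pow_mul, mul_comm]

/-- Bézout: both `a ^ m` and `a ^ N` are `N`-th powers. -/
theorem exists_pow_gcd_eq_pow {M : Type*} [CommGroup M] {a c : M} {m N : ℕ} (h : a ^ m = c ^ N) :
    ∃ d : M, a ^ m.gcd N = d ^ N := by
  refine ⟨c ^ m.gcdA N * a ^ m.gcdB N, ?_⟩
  rw [← zpow_natCast a (m.gcd N), Nat.gcd_eq_gcd_ab, zpow_add, zpow_mul, zpow_mul, zpow_natCast,
    zpow_natCast, h, mul_pow, ← zpow_natCast (c ^ _), ← zpow_natCast (a ^ _), ← zpow_natCast c,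
    ← zpow_natCast a, ← zpow_mul, ← zpow_mul, ← zpow_mul, ← zpow_mul, mul_comm (N : ℤ) (m.gcdA N),
    mul_comm (N : ℤ) (m.gcdB N)]

theorem exists_pow_eq_pow_of_gcd_dvd {M : Type*} [CommGroup M] {a c : M} {m N l : ℕ}
    (h : a ^ m = c ^ N) (hl : m.gcd N ∣ l) : ∃ d : M, a ^ l = d ^ N := by
  obtain ⟨d, hd⟩ := exists_pow_gcd_eq_pow h
  obtain ⟨e, rfl⟩ := hl
  exact ⟨d ^ e, by rw [pow_mul, hd, ← pow_mul, ← pow_mul, mul_comm]⟩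

/-! ### Lifts of the components of an element of the completion -/

section Lifts

variable {p : ℕ} {M N : Type*} [CommGroup M] [CommGroup N] {x y : PCompletion p M} {n m : ℕ}
  {a b : M}

theorem exists_isLiftAt (x : PCompletion p M) (n : ℕ) : ∃ a : M, IsLiftAt p x n a := by
  obtain ⟨a, ha⟩ := Submodule.Quotient.mk_surjective _
    (AdicCompletion.eval (Ideal.span {(p : ℤ)}) (Additive M) n x)
  exact ⟨a.toMul, ha.symm⟩

theorem IsLiftAt.exists_eq_mul_pow (ha : IsLiftAt p x n a) (hb : IsLiftAt p x n b) :
    ∃ d : M, a = b * d ^ p ^ n := by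
  have h : (Submodule.Quotient.mk (Additive.ofMul a) :
      Additive M ⧸ (Ideal.span {(p : ℤ)} ^ n • ⊤ : Submodule ℤ (Additive M))) =
      Submodule.Quotient.mk (Additive.ofMul b) := ha.symm.trans hb
  rw [Submodule.Quotient.eq, mem_span_pow_smul_top] at h
  obtain ⟨d, hd⟩ := h
  have hd' : a / b = d.toMul ^ p ^ n := hd
  exact ⟨d.toMul, by rw [← hd', mul_div_cancel]⟩

theorem IsLiftAt.mul_pow (hb : IsLiftAt p x n b) (d : M) : IsLiftAt p x n (b * d ^ p ^ n) := by
  refine Eq.trans hb ?_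
  symm
  rw [Submodule.Quotient.eq, mem_span_pow_smul_top]
  exact ⟨Additive.ofMul d, show b * d ^ p ^ n / b = d ^ p ^ n by rw [mul_div_cancel_left]⟩

theorem IsLiftAt.mono (ha : IsLiftAt p x m a) (h : n ≤ m) : IsLiftAt p x n a := by
  have h1 := AdicCompletion.transitionMap_comp_eval_apply (I := Ideal.span {(p : ℤ)})
    (M := Additive M) h x
  have h2 : x.val m = Submodule.Quotient.mk (Additive.ofMul a) := ha
  rw [h2] at h1
  exact h1.symm

theorem IsLiftAt.map (f : M →* N) (ha : IsLiftAt p x n a) :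
    IsLiftAt p (PCompletion.map p f x) n (f a) := by
  have h2 : x.val n = Submodule.Quotient.mk (Additive.ofMul a) := ha
  change (AdicCompletion.map _ _ x).val n = _
  rw [AdicCompletion.map_val_apply, h2]
  rfl

theorem IsLiftAt.nsmul (k : ℕ) (ha : IsLiftAt p x n a) : IsLiftAt p (k • x) n (a ^ k) := by
  have h2 : AdicCompletion.eval (Ideal.span {(p : ℤ)}) (Additive M) n x =
    Submodule.Quotient.mk (Additive.ofMul a) := ha
  unfold IsLiftAt
  rw [map_nsmul, h2]
  rfl

theorem isLiftAt_zero_one (n : ℕ) : IsLiftAt p (0 : PCompletion p M) n 1 := rfl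

theorem isLiftAt_zero_iff : IsLiftAt p (0 : PCompletion p M) n a ↔ ∃ d : M, a = d ^ p ^ n := by
  constructor
  · intro h
    obtain ⟨d, hd⟩ := h.exists_eq_mul_pow (isLiftAt_zero_one n)
    exact ⟨d, by rw [hd, one_mul]⟩
  · rintro ⟨d, rfl⟩
    simpa using (isLiftAt_zero_one (M := M) (p := p) n).mul_pow d

theorem eq_of_isLiftAt (h : ∀ n, ∃ a, IsLiftAt p x n a ∧ IsLiftAt p y n a) : x = y := by
  refine AdicCompletion.ext fun n => ?_
  obtain ⟨a, h1, h2⟩ := h n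
  exact Eq.trans h1 h2.symm

/-- An element of the completion is torsion if and only if it is killed by a power of `p`. -/
theorem isOfFinAddOrder_iff_exists_pow [Fact p.Prime] : IsOfFinAddOrder x ↔
    ∃ k : ℕ, ∀ (n : ℕ) (a : M), IsLiftAt p x n a → ∃ c : M, a ^ p ^ k = c ^ p ^ n := by
  have hp : p.Prime := Fact.out
  rw [isOfFinAddOrder_iff_nsmul_eq_zero]
  constructor
  · rintro ⟨m, hm, hx⟩
    obtain ⟨k, m', hm', rfl⟩ := Nat.exists_eq_pow_mul_and_not_dvd hm.ne' p hp.ne_one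
    refine ⟨k, fun n a ha => ?_⟩
    have h1 := ha.nsmul (p ^ k * m')
    rw [hx, isLiftAt_zero_iff] at h1
    obtain ⟨c, hc⟩ := h1
    -- The factor of the exponent prime to `p` is harmless modulo `p^n`-th powers.
    refine exists_pow_eq_pow_of_gcd_dvd hc ?_
    have hco : Nat.Coprime m' (p ^ n) := (((Nat.Prime.coprime_iff_not_dvd hp).2 hm').symm).pow_right n
    rw [Nat.Coprime.gcd_mul_right_cancel _ hco]
    exact Nat.gcd_dvd_left _ _
  · rintro ⟨k, hk⟩
    refine ⟨p ^ k, pow_pos hp.pos k, eq_of_isLiftAt fun n => ?_⟩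
    obtain ⟨a, ha⟩ := exists_isLiftAt x n
    exact ⟨_, ha.nsmul _, isLiftAt_zero_iff.2 (hk n a ha)⟩

/-- The completion contains every compatible sequence. -/
theorem exists_forall_isLiftAt (s : ℕ → M) (hs : ∀ n, ∃ d : M, s (n + 1) = s n * d ^ p ^ n) :
    ∃ x : PCompletion p M, ∀ n, IsLiftAt p x n (s n) := by
  have hs' : ∀ n, (Additive.ofMul (s n)) ≡ (Additive.ofMul (s (n + 1)))
      [SMOD (Ideal.span {(p : ℤ)} ^ n • ⊤ : Submodule ℤ (Additive M))] := fun n => by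
    obtain ⟨d, hd⟩ := hs n
    symm
    rw [SModEq.sub_mem, mem_span_pow_smul_top]
    exact ⟨Additive.ofMul d, show s (n + 1) / s n = d ^ p ^ n by rw [hd, mul_div_cancel_left]⟩
  exact ⟨AdicCompletion.mk _ _ (AdicCompletion.AdicCauchySequence.mk _ _ _ hs'), fun n => rfl⟩

/-- The difference `x - a` has zero component at level `n`, hence so does its image in the
completion of `ℤ_p`, which is `ℤ_p` itself. This lets `p`-adic valuations be read off from lifts. -/
theorem IsLiftAt.pow_dvd_extend_sub [Fact p.Prime] (v : Additive M →+ ℤ) (ha : IsLiftAt p x n a) :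
    (p : ℤ_[p]) ^ n ∣ PCompletion.extend p v x - v (Additive.ofMul a) := by
  rw [← PCompletion.extend_of p v a, ← map_sub]
  set y := x - toPCompletion p M (Additive.ofMul a) with hy
  have hy0 : y.val n = 0 := by
    have h2 : x.val n = Submodule.Quotient.mk (Additive.ofMul a) := ha
    have h3 : y.val n = x.val n - (toPCompletion p M (Additive.ofMul a)).val n := rfl
    rw [h3, h2]
    exact sub_self _
  set z := AdicCompletion.map (Ideal.span {(p : ℤ)})
    ((Int.castAddHom ℤ_[p]).comp v).toIntLinearMap y with hz
  have hz0 : z.val n = 0 := by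
    rw [hz, AdicCompletion.map_val_apply, hy0, map_zero]
  have hw : AdicCompletion.of (Ideal.span {(p : ℤ)}) ℤ_[p] (PCompletion.extend p v y) = z :=
    (AdicCompletion.ofLinearEquiv (Ideal.span {(p : ℤ)}) ℤ_[p]).apply_symm_apply z
  rw [← hw] at hz0
  have h4 := (Submodule.Quotient.mk_eq_zero _).1 hz0
  rw [mem_span_pow_smul_top] at h4
  obtain ⟨b, hb⟩ := h4
  exact ⟨b, by rw [hb, nsmul_eq_mul]; push_cast; rfl⟩

end Lifts

/-! ### Valuations of elements of `F` -/

section Valuation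

variable {F : Type*} [Field F] [NumberField F]

/-- The normalized additive valuation at `q` on `F^*`. -/
def ord (q : HeightOneSpectrum (𝓞 F)) : Additive Fˣ →+ ℤ :=
  (localVal q).comp (Units.map (algebraMap F (q.adicCompletion F)).toMonoidHom).toAdditive

theorem valuation_eq_exp_ord (q : HeightOneSpectrum (𝓞 F)) (a : Fˣ) :
    q.valuation F (a : F) = WithZero.exp (-ord q (Additive.ofMul a)) := by
  have h := valued_eq_exp_localVal q
    (Units.map (algebraMap F (q.adicCompletion F)).toMonoidHom a)
  rw [← q.valuedAdicCompletion_eq_valuation']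
  exact h

theorem mem_qUnits_iff {Q : Finset (HeightOneSpectrum (𝓞 F))} {a : Fˣ} :
    a ∈ qUnits Q ↔ ∀ q ∉ Q, ord q (Additive.ofMul a) = 0 := by
  refine forall₂_congr fun q _ => ?_
  rw [valuation_eq_exp_ord, ← WithZero.exp_zero, WithZero.exp_inj, neg_eq_zero]

theorem IsLiftAt.pow_dvd_completedVal_sub {p : ℕ} [Fact p.Prime] {x : PCompletion p Fˣ} {n : ℕ}
    {a : Fˣ} (ha : IsLiftAt p x n a) (q : HeightOneSpectrum (𝓞 F)) :
    (p : ℤ_[p]) ^ n ∣ completedVal p q x - ord q (Additive.ofMul a) :=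
  (ha.map _).pow_dvd_extend_sub (localVal q)

theorem finite_setOf_ord_ne_zero (a : Fˣ) :
    {q : HeightOneSpectrum (𝓞 F) | ord q (Additive.ofMul a) ≠ 0}.Finite := by
  refine ((HeightOneSpectrum.Support.finite (𝓞 F) (a : F)).union
    (HeightOneSpectrum.Support.finite (𝓞 F) ((a⁻¹ : Fˣ) : F))).subset fun q hq => ?_
  have h : ord q (Additive.ofMul a⁻¹) = -ord q (Additive.ofMul a) := map_neg (ord q) _
  rcases lt_or_gt_of_ne hq with h0 | h0
  · refine Or.inl (?_ : 1 < q.valuation F (a : F))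
    rw [valuation_eq_exp_ord, ← WithZero.exp_zero, WithZero.exp_lt_exp]
    omega
  · refine Or.inr (?_ : 1 < q.valuation F ((a⁻¹ : Fˣ) : F))
    rw [valuation_eq_exp_ord, ← WithZero.exp_zero, WithZero.exp_lt_exp, h]
    omega

-- The class number kills the class of `q`; a generator of the resulting principal power is the
-- required element.
open Classical in
theorem exists_ord_eq_single (q : HeightOneSpectrum (𝓞 F)) : ∃ b : Fˣ, ∀ q' : HeightOneSpectrum (𝓞 F),
    ord q' (Additive.ofMul b) =
      Nat.card (ClassGroup (𝓞 F)) * (Finsupp.single q (1 : ℤ)) q' := by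
  set H := Nat.card (ClassGroup (𝓞 F)) with hH
  have hq : q.asIdeal ∈ nonZeroDivisors (Ideal (𝓞 F)) := mem_nonZeroDivisors_of_ne_zero q.ne_bot
  have h1 : ClassGroup.mk0 (⟨q.asIdeal, hq⟩ ^ H : nonZeroDivisors (Ideal (𝓞 F))) = 1 := by
    rw [map_pow, hH, pow_card_eq_one']
  rw [ClassGroup.mk0_eq_one_iff] at h1
  obtain ⟨b, hb⟩ := h1
  have hb' : q.asIdeal ^ H = Ideal.span {b} := hb
  have hb0 : b ≠ 0 := by
    rintro rfl
    simp only [Set.singleton_zero, Ideal.span_zero] at hb'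
    exact pow_ne_zero H q.ne_bot hb'
  have hbF : algebraMap (𝓞 F) F b ≠ 0 := by simpa using hb0
  refine ⟨Units.mk0 _ hbF, fun q' => ?_⟩
  have h2 := valuation_eq_exp_ord q' (Units.mk0 _ hbF)
  rw [Units.val_mk0, HeightOneSpectrum.valuation_of_algebraMap,
    HeightOneSpectrum.intValuation_if_neg _ hb0, ← hb', Associates.mk_pow,
    Associates.count_pow (Associates.mk_ne_zero.2 q.ne_bot) q'.associates_irreducible,
    WithZero.exp_inj, neg_inj] at h2
  rw [← h2]
  push_cast
  congr 1
  rw [Finsupp.single_apply]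
  split_ifs with h
  · subst h
    exact_mod_cast Associates.count_self q.associates_irreducible
  · have := Associates.count_eq_zero_of_ne q'.associates_irreducible q.associates_irreducible
      (fun h' => h (HeightOneSpectrum.ext
        (associated_iff_eq.1 (Associates.mk_eq_mk_iff_associated.1 h'.symm))))
    exact_mod_cast this

theorem exists_ord_eq_card_mul (d : HeightOneSpectrum (𝓞 F) →₀ ℤ) :
    ∃ b : Fˣ, ∀ q, ord q (Additive.ofMul b) = Nat.card (ClassGroup (𝓞 F)) * d q := by
  induction d using Finsupp.induction_linear with
  | zero => exact ⟨1, fun q => by simp⟩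
  | add f g hf hg =>
    obtain ⟨b, hb⟩ := hf
    obtain ⟨c, hc⟩ := hg
    exact ⟨b * c, fun q => by rw [ofMul_mul, map_add, hb, hc, Finsupp.add_apply, mul_add]⟩
  | single q z =>
    obtain ⟨b, hb⟩ := exists_ord_eq_single q
    refine ⟨b ^ z, fun q' => ?_⟩
    rw [ofMul_zpow, map_zsmul, hb, smul_eq_mul, ← mul_one z, ← smul_eq_mul z 1,
      ← Finsupp.smul_single, Finsupp.smul_apply, smul_eq_mul, smul_eq_mul]
    ring

end Valuation

/-! ### The completion of the group of `Q`-units -/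

section QUnits

variable {F : Type*} [Field F] [NumberField F] {p : ℕ}
  {Q : Finset (HeightOneSpectrum (𝓞 F))} {x : PCompletion p Fˣ}

theorem exists_mem_qUnits_isLiftAt_of_mem (hx : x ∈ completedQUnits p Q) (n : ℕ) :
    ∃ e ∈ qUnits Q, IsLiftAt p x n e := by
  obtain ⟨y, rfl⟩ := hx
  obtain ⟨e, he⟩ := exists_isLiftAt y n
  exact ⟨e, e.2, he.map _⟩

variable [Fact p.Prime]

/-- Successive lifts differ by `p^n`-th powers in `F^*`. Their roots are again `Q`-units because
valuations are torsion-free, so the lifts are compatible in `E_Q` too. -/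
theorem mem_completedQUnits_of_forall (h : ∀ n, ∃ e ∈ qUnits Q, IsLiftAt p x n e) :
    x ∈ completedQUnits p Q := by
  choose e he hx using h
  have hp : p.Prime := Fact.out
  obtain ⟨y, hy⟩ := exists_forall_isLiftAt (p := p) (fun n => (⟨e n, he n⟩ : qUnits Q)) fun n => by
    obtain ⟨d, hd⟩ := ((hx (n + 1)).mono n.le_succ).exists_eq_mul_pow (hx n)
    have hmem : d ∈ qUnits Q := by
      have hd' : d ^ p ^ n ∈ qUnits Q := by
        rw [← inv_mul_eq_iff_eq_mul.2 hd]
        exact mul_mem (inv_mem (he n)) (he (n + 1))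
      rw [mem_qUnits_iff] at hd' ⊢
      intro q hq
      have := hd' q hq
      rw [ofMul_pow, map_nsmul, nsmul_eq_mul] at this
      exact (mul_eq_zero.1 this).resolve_left (by exact_mod_cast pow_ne_zero n hp.ne_zero)
    exact ⟨⟨d, hmem⟩, Subtype.ext hd⟩
  exact ⟨y, eq_of_isLiftAt fun n => ⟨e n, (hy n).map (qUnits Q).subtype, hx n⟩⟩

theorem completedVal_eq_zero_of_mem (hx : x ∈ completedQUnits p Q)
    {q : HeightOneSpectrum (𝓞 F)} (hq : q ∉ Q) : completedVal p q x = 0 := by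
  by_contra h0
  obtain ⟨n, hn⟩ : ∃ n, ¬ (p : ℤ_[p]) ^ n ∣ completedVal p q x := by
    obtain ⟨n, hn⟩ := FiniteMultiplicity.of_prime_left PadicInt.prime_p h0
    exact ⟨_, hn⟩
  obtain ⟨e, he, hl⟩ := exists_mem_qUnits_isLiftAt_of_mem hx n
  have h1 := hl.pow_dvd_completedVal_sub q
  rw [mem_qUnits_iff.1 he q hq, Int.cast_zero, sub_zero] at h1
  exact hn h1

-- Let `p^k` be the `p`-part of the class number `H`. A lift `a` of level `n + k` has divisor
-- `p^(n+k) d` away from `Q`, while `H d` is the divisor of some `b`. Bézout yields `c` with divisor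
-- `p^k d` away from `Q`, and `a / c^(p^n)` is the wanted `Q`-unit.
open Classical in
theorem exists_mem_qUnits_isLiftAt (h : ∀ q ∉ Q, completedVal p q x = 0) (n : ℕ) :
    ∃ e ∈ qUnits Q, IsLiftAt p x n e := by
  have hp : p.Prime := Fact.out
  set H := Nat.card (ClassGroup (𝓞 F)) with hH
  have hH0 : H ≠ 0 := Nat.card_pos.ne'
  obtain ⟨k, m, hm, hHk⟩ := Nat.exists_eq_pow_mul_and_not_dvd hH0 p hp.ne_one
  obtain ⟨a, ha⟩ := exists_isLiftAt x (n + k)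
  have hdvd : ∀ q ∉ Q, (p : ℤ) ^ (n + k) ∣ ord q (Additive.ofMul a) := fun q hq => by
    have h1 := ha.pow_dvd_completedVal_sub q
    rw [h q hq, zero_sub, dvd_neg] at h1
    exact_mod_cast (PadicInt.pow_p_dvd_int_iff _ _).1 h1
  choose! d hd using hdvd
  set f : HeightOneSpectrum (𝓞 F) →₀ ℤ := Finsupp.onFinset (finite_setOf_ord_ne_zero a).toFinset
    (fun q => if q ∈ Q then 0 else d q) (fun q hq => by
      have hqQ : q ∉ Q := fun h' => hq (if_pos h')
      rw [if_neg hqQ] at hq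
      rw [Set.Finite.mem_toFinset]
      change ord q (Additive.ofMul a) ≠ 0
      rw [hd q hqQ]
      exact mul_ne_zero (pow_ne_zero _ (by exact_mod_cast hp.ne_zero)) hq) with hf
  have hfq : ∀ q ∉ Q, f q = d q := fun q hq => if_neg hq
  obtain ⟨b, hb⟩ := exists_ord_eq_card_mul f
  have hgcd : H.gcd (p ^ (n + k)) = p ^ k := by
    rw [hHk, pow_add, mul_comm (p ^ n), Nat.gcd_mul_left]
    rw [Nat.Coprime.gcd_eq_one, mul_one]
    exact (((Nat.Prime.coprime_iff_not_dvd hp).2 hm).symm).pow_right n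
  have hbez := Nat.gcd_eq_gcd_ab H (p ^ (n + k))
  rw [hgcd] at hbez
  set c : Fˣ := b ^ H.gcdA (p ^ (n + k)) * a ^ H.gcdB (p ^ (n + k)) with hc
  have hcq : ∀ q ∉ Q, ord q (Additive.ofMul c) = p ^ k * d q := fun q hq => by
    have hbez' : (p : ℤ) ^ k = H * H.gcdA (p ^ (n + k)) + p ^ (n + k) * H.gcdB (p ^ (n + k)) := by
      exact_mod_cast hbez
    rw [hc, ofMul_mul, map_add, ofMul_zpow, ofMul_zpow, map_zsmul, map_zsmul, hb, hfq q hq,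
      hd q hq, hbez', smul_eq_mul, smul_eq_mul]
    ring
  refine ⟨a * c⁻¹ ^ p ^ n, mem_qUnits_iff.2 fun q hq => ?_, (ha.mono (n.le_add_right k)).mul_pow _⟩
  rw [ofMul_mul, map_add, ofMul_pow, map_nsmul, ofMul_inv, map_neg, hcq q hq, hd q hq]
  simp only [nsmul_eq_mul]
  push_cast
  ring

theorem mem_completedQUnits_iff :
    x ∈ completedQUnits p Q ↔ ∀ q ∉ Q, completedVal p q x = 0 :=
  ⟨fun hx _ hq => completedVal_eq_zero_of_mem hx hq,
    fun h => mem_completedQUnits_of_forall (exists_mem_qUnits_isLiftAt h)⟩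

end QUnits

/-! ### Roots of unity near `1` -/

section RootsNearOne

variable {L Γ : Type*} [Field L] [LinearOrderedCommGroupWithZero Γ] (v : Valuation L Γ)

theorem valuation_pow_sub_one_le {z : L} (hz : v z ≤ 1) (i : ℕ) : v (z ^ i - 1) ≤ v (z - 1) := by
  rw [← geom_sum_mul, map_mul]
  refine mul_le_of_le_one_left' (v.map_sum_le fun j _ => ?_)
  rw [map_pow]
  exact pow_le_one₀ zero_le hz

theorem valuation_eq_one_of_pow_eq_one {z : L} {n : ℕ} (hn : n ≠ 0) (h : z ^ n = 1) : v z = 1 := by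
  have := congrArg v h
  rw [map_pow, map_one] at this
  exact (pow_eq_one_iff_of_nonneg zero_le hn).1 this

/-- Otherwise some power `w` of `z` has order exactly `p`. From `1 + w + ... + w^(p-1) = 0` one gets
`p = -∑ (w^i - 1)`, hence `v p ≤ v (w - 1) ≤ v (z - 1)`. -/
theorem eq_one_of_valuation_sub_one_lt {p n : ℕ} (hp : p.Prime) {z : L} (hz : z ^ p ^ n = 1)
    (h : v (z - 1) < v p) : z = 1 := by
  by_contra hne
  obtain ⟨j, hj1, hj2⟩ : ∃ j, z ^ p ^ j ≠ 1 ∧ z ^ p ^ (j + 1) = 1 := by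
    by_contra! hcon
    have : ∀ j, z ^ p ^ j ≠ 1 := fun j => by
      induction j with
      | zero => simpa using hne
      | succ j ih => exact hcon j ih
    exact this n hz
  have hvz := valuation_eq_one_of_pow_eq_one v (pow_ne_zero n hp.ne_zero) hz
  set w := z ^ p ^ j with hw
  have hwp : w ^ p = 1 := by rw [hw, ← pow_mul, ← pow_succ, hj2]
  have hsum : ∑ i ∈ Finset.range p, w ^ i = 0 := by
    have := geom_sum_mul w p
    rw [hwp, sub_self] at this
    exact (mul_eq_zero.1 this).resolve_right (sub_ne_zero.2 hj1)
  have hp' : (p : L) = -∑ i ∈ Finset.range p, (w ^ i - 1) := by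
    rw [Finset.sum_sub_distrib, hsum]
    simp
  have hle : v p ≤ v (w - 1) := by
    rw [hp', Valuation.map_neg]
    refine v.map_sum_le fun i _ => valuation_pow_sub_one_le v ?_ i
    rw [hw, map_pow, hvz, one_pow]
  exact absurd (hle.trans (valuation_pow_sub_one_le v hvz.le _)) h.not_ge

/-- If `z ^ N` is close to `1`, then `z` is close to an `N`-th root of unity. -/
theorem exists_valuation_sub_le {N : ℕ} [NeZero N] {ζ : L} (hζ : IsPrimitiveRoot ζ N) {z t : L}
    (h : v (z ^ N - 1) ≤ v t ^ N) : ∃ ξ : L, ξ ^ N = 1 ∧ v (z - ξ) ≤ v t := by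
  have hN : N ≠ 0 := NeZero.ne N
  have hprod : ∏ ξ ∈ Polynomial.nthRootsFinset N (1 : L), (z - ξ) = z ^ N - 1 := by
    have := congrArg (Polynomial.eval z) (Polynomial.X_pow_sub_one_eq_prod (Nat.pos_of_ne_zero hN) hζ)
    rw [Polynomial.eval_prod] at this
    simpa using this.symm
  -- Take the root of unity nearest to `z`: the `N`-th power of that smallest factor is at most the
  -- product `z^N - 1`.
  obtain ⟨ξ, hξ, hmin⟩ := Finset.exists_min_image (Polynomial.nthRootsFinset N (1 : L))
    (fun ξ => v (z - ξ)) ⟨1, Polynomial.one_mem_nthRootsFinset (Nat.pos_of_ne_zero hN)⟩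
  refine ⟨ξ, (Polynomial.mem_nthRootsFinset (Nat.pos_of_ne_zero hN) 1).1 hξ, ?_⟩
  have h1 := Finset.pow_card_le_prod _ (fun ξ => v (z - ξ)) _ hmin
  rw [hζ.card_nthRootsFinset, ← map_prod, hprod] at h1
  exact (pow_le_pow_iff_left₀ zero_le zero_le hN).1 (h1.trans h)

end RootsNearOne

/-! ### The valuation of a prime of an algebraic extension of `ℚ` -/

section Place

variable {L : Type*} [Field L] [CharZero L] [Algebra.IsAlgebraic ℚ L]

/-- `L` may be infinite over `ℚ` and `𝓞 L` not Dedekind, so the question is moved to the number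
field `ℚ(x)`, where the localization at the contracted prime is a field or a discrete valuation
ring. -/
theorem exists_mul_eq_notMem (P : Ideal (𝓞 L)) [P.IsPrime] (x : L) :
    ∃ a b : 𝓞 L, x * b = a ∧ (a ∉ P ∨ b ∉ P) := by
  have hx : IsIntegral ℚ x := (Algebra.IsAlgebraic.isAlgebraic x).isIntegral
  let E := IntermediateField.adjoin ℚ {x}
  have : FiniteDimensional ℚ E := IntermediateField.adjoin.finiteDimensional hx
  have : NumberField E := ⟨⟩
  let e : E := ⟨x, IntermediateField.mem_adjoin_simple_self ℚ x⟩
  have hex : algebraMap E L e = x := rfl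
  let f := algebraMap (𝓞 E) (𝓞 L)
  have hf : ∀ c : 𝓞 E, algebraMap E L c = (f c : L) := fun c => rfl
  have key : ∀ (a b : 𝓞 E) (y : E), y * b = a → algebraMap E L y * f b = f a := by
    intro a b y h
    rw [← hf, ← hf, ← map_mul, h]
  by_cases hI : P.comap f = ⊥
  · obtain ⟨a, b, hb, hab⟩ := IsFractionRing.div_surjective (A := 𝓞 E) e
    have hb0 : b ≠ 0 := nonZeroDivisors.ne_zero hb
    refine ⟨f a, f b, key a b e (by rw [← hab]; exact div_mul_cancel₀ _ (by simpa using hb0)),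
      Or.inr fun h => hb0 ?_⟩
    have : b ∈ P.comap f := h
    rwa [hI] at this
  · obtain ⟨c, ⟨d, hd⟩, h | h⟩ := HeightOneSpectrum.exists_primeCompl_mul_eq_or_mul_eq
      ⟨P.comap f, inferInstance, hI⟩ e
    · exact ⟨f c, f d, key c d e h, Or.inr hd⟩
    · exact ⟨f d, f c, key d c e h, Or.inl hd⟩

/-- The localization of the ring of integers of `L` at a prime, which is a valuation ring. -/
def placeRing (P : Ideal (𝓞 L)) [hP : P.IsPrime] : ValuationSubring L where
  carrier := {x | ∃ a b : 𝓞 L, b ∉ P ∧ x * b = a}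
  mul_mem' := by
    rintro x y ⟨a, b, hb, h⟩ ⟨c, d, hd, h'⟩
    refine ⟨a * c, b * d, hP.mul_notMem hb hd, ?_⟩
    change x * y * ((b : L) * (d : L)) = (a : L) * (c : L)
    rw [← h, ← h']
    ring
  one_mem' := ⟨1, 1, hP.one_notMem, by simp⟩
  add_mem' := by
    rintro x y ⟨a, b, hb, h⟩ ⟨c, d, hd, h'⟩
    refine ⟨a * d + c * b, b * d, hP.mul_notMem hb hd, ?_⟩
    change (x + y) * ((b : L) * (d : L)) = (a : L) * (d : L) + (c : L) * (b : L)
    rw [← h, ← h']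
    ring
  zero_mem' := ⟨0, 1, hP.one_notMem, by simp⟩
  neg_mem' := by
    rintro x ⟨a, b, hb, h⟩
    exact ⟨-a, b, hb, (neg_mul x (b : L)).trans (congrArg Neg.neg h)⟩
  mem_or_inv_mem' := by
    intro x
    obtain ⟨a, b, h, hP'⟩ := exists_mul_eq_notMem P x
    by_cases hb : b ∈ P
    · have ha := hP'.resolve_right (not_not.2 hb)
      have ha0 : (a : L) ≠ 0 := by
        intro h0
        have : a = 0 := by exact_mod_cast h0
        exact ha (this ▸ Ideal.zero_mem _)
      have hx0 : x ≠ 0 := by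
        rintro rfl
        exact ha0 (by rw [← h, zero_mul])
      exact Or.inr ⟨b, a, ha, by rw [← h, inv_mul_cancel_left₀ hx0]⟩
    · exact Or.inl ⟨a, b, hb, h⟩

variable (P : Ideal (𝓞 L)) [hP : P.IsPrime]

theorem placeRing_valuation_le_one_iff {x : L} :
    (placeRing P).valuation x ≤ 1 ↔ ∃ a b : 𝓞 L, b ∉ P ∧ x * b = a :=
  (placeRing P).valuation_le_one_iff x

theorem placeRing_valuation_coe_le_one (a : 𝓞 L) : (placeRing P).valuation (a : L) ≤ 1 :=
  (placeRing_valuation_le_one_iff P).2 ⟨a, 1, hP.one_notMem, by simp⟩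

theorem placeRing_valuation_lt_one_iff (a : 𝓞 L) : (placeRing P).valuation (a : L) < 1 ↔ a ∈ P := by
  constructor
  · contrapose!
    intro ha
    have ha0 : (a : L) ≠ 0 := by
      intro h0
      have : a = 0 := by exact_mod_cast h0
      exact ha (this ▸ Ideal.zero_mem _)
    have h : (placeRing P).valuation (a : L)⁻¹ ≤ 1 :=
      (placeRing_valuation_le_one_iff P).2 ⟨1, a, ha, by simp [ha0]⟩
    rw [map_inv₀] at h
    exact (inv_le_one₀ (zero_lt_iff.2 ((Valuation.ne_zero_iff _).2 ha0))).1 h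
  · intro ha
    by_contra hcon
    have hle := not_lt.1 hcon
    have ha0 : (a : L) ≠ 0 := by
      intro h0
      rw [h0, map_zero] at hle
      exact absurd hle (not_le.2 zero_lt_one)
    have h : (placeRing P).valuation (a : L)⁻¹ ≤ 1 := by
      rw [map_inv₀]
      exact inv_le_one_of_one_le₀ hle
    obtain ⟨c, d, hd, h'⟩ := (placeRing_valuation_le_one_iff P).1 h
    rw [inv_mul_eq_iff_eq_mul₀ ha0] at h'
    have : d = a * c := by exact_mod_cast h'
    exact hd (this ▸ P.mul_mem_right c ha)

variable {K : Type*} [Field K] [Algebra K L] {σ : L ≃ₐ[K] L}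

theorem placeRing_valuation_map_le_one (hσ : σ ∈ P.inertia (L ≃ₐ[K] L)) {x : L}
    (hx : (placeRing P).valuation x ≤ 1) : (placeRing P).valuation (σ x) ≤ 1 := by
  rw [placeRing_valuation_le_one_iff] at hx ⊢
  obtain ⟨a, b, hb, h⟩ := hx
  refine ⟨σ • a, σ • b, fun hmem => hb ?_, ?_⟩
  · simpa using P.sub_mem hmem (hσ b)
  · change σ x * σ b = σ a
    rw [← map_mul, h]

/-- For `x = a / b`, the numerator of `σ x - x` is `(σ a - a) b - a (σ b - b)`, which lies in `P`;
its denominator `b · σ b` does not. -/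
theorem placeRing_valuation_map_sub_lt_one (hσ : σ ∈ P.inertia (L ≃ₐ[K] L)) {x : L}
    (hx : (placeRing P).valuation x ≤ 1) : (placeRing P).valuation (σ x - x) < 1 := by
  obtain ⟨a, b, hb, h⟩ := (placeRing_valuation_le_one_iff P).1 hx
  have hb' : σ • b ∉ P := fun hmem => hb (by simpa using P.sub_mem hmem (hσ b))
  have h' : σ x * (σ • b : 𝓞 L) = (σ • a : 𝓞 L) := by
    change σ x * σ b = σ a
    rw [← map_mul, h]
  have h1 : (σ x - x) * ((b * σ • b : 𝓞 L) : L) = ((σ • a * b - a * σ • b : 𝓞 L) : L) := by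
    change (σ x - x) * ((b : L) * (σ • b : 𝓞 L)) =
      (σ • a : 𝓞 L) * (b : L) - (a : L) * (σ • b : 𝓞 L)
    rw [← h, ← h']
    ring
  have hnum : σ • a * b - a * σ • b ∈ P := by
    have : σ • a * b - a * σ • b = (σ • a - a) * b - a * (σ • b - b) := by ring
    rw [this]
    exact P.sub_mem (P.mul_mem_right _ (hσ a)) (P.mul_mem_left _ (hσ b))
  have h2 := congrArg (placeRing P).valuation h1
  have h3 : (placeRing P).valuation ((b * σ • b : 𝓞 L) : L) = 1 :=
    le_antisymm (placeRing_valuation_coe_le_one P _)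
      (not_lt.1 fun hlt => hP.mul_notMem hb hb' ((placeRing_valuation_lt_one_iff P _).1 hlt))
  rw [map_mul, h3, mul_one] at h2
  rw [h2]
  exact (placeRing_valuation_lt_one_iff P _).2 hnum

end Place

/-! ### Action of inertia on radicals -/

section Unramified

variable {F L : Type*} [Field F] [NumberField F] [Field L] [CharZero L] [Algebra.IsAlgebraic ℚ L]
  [Algebra F L] {q : HeightOneSpectrum (𝓞 F)} (P : Ideal (𝓞 L)) [P.IsPrime]

omit [NumberField F] in
theorem placeRing_valuation_algebraMap_lt_one_iff
    (hPq : P.comap (algebraMap (𝓞 F) (𝓞 L)) = q.asIdeal) (a : 𝓞 F) :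
    (placeRing P).valuation (algebraMap F L a) < 1 ↔ a ∈ q.asIdeal := by
  rw [← hPq, Ideal.mem_comap, ← placeRing_valuation_lt_one_iff]
  rfl

theorem placeRing_valuation_algebraMap_le_one
    (hPq : P.comap (algebraMap (𝓞 F) (𝓞 L)) = q.asIdeal) {e : F} (he : q.valuation F e ≤ 1) :
    (placeRing P).valuation (algebraMap F L e) ≤ 1 := by
  have hint : ∀ c : 𝓞 F, (placeRing P).valuation (algebraMap F L c) ≤ 1 := fun c =>
    placeRing_valuation_coe_le_one P (algebraMap (𝓞 F) (𝓞 L) c)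
  have hq : ∀ c : 𝓞 F, c ∉ q.asIdeal → (placeRing P).valuation (algebraMap F L c) = 1 :=
    fun c hc => le_antisymm (hint c)
      (not_lt.1 fun h => hc ((placeRing_valuation_algebraMap_lt_one_iff P hPq c).1 h))
  obtain ⟨s, ⟨t, ht⟩, hst⟩ := q.exists_primeCompl_mul_eq_of_integer e he
  have h3 := congrArg (fun y => (placeRing P).valuation (algebraMap F L y)) hst
  simp only [map_mul] at h3
  rw [hq t ht, mul_one] at h3
  rw [h3]
  exact hint s

variable {K : Type*} [Field K] [Algebra K L] [Algebra F K] [IsScalarTower F K L]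
  {σ : L ≃ₐ[K] L} {p : ℕ}

theorem map_algebraMap_of_tower {F K L : Type*} [Field F] [Field K] [Field L] [Algebra F L]
    [Algebra K L] [Algebra F K] [IsScalarTower F K L] (σ : L ≃ₐ[K] L) (a : F) :
    σ (algebraMap F L a) = algebraMap F L a := by
  rw [IsScalarTower.algebraMap_apply F K L, σ.commutes]

/-- Inertia acts trivially on the `p ^ n`-th roots of a unit at `q`, if `q` is not above `p`. -/
theorem map_eq_self_of_ord_eq_zero (hp : p.Prime)
    (hPq : P.comap (algebraMap (𝓞 F) (𝓞 L)) = q.asIdeal) (hσ : σ ∈ P.inertia (L ≃ₐ[K] L))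
    (hpq : (p : 𝓞 F) ∉ q.asIdeal) {e : Fˣ} (he : ord q (Additive.ofMul e) = 0) {n : ℕ} {y : L}
    (hy : y ^ p ^ n = algebraMap F L e) : σ y = y := by
  have hN : p ^ n ≠ 0 := pow_ne_zero n hp.ne_zero
  have hve : (placeRing P).valuation (algebraMap F L e) = 1 := by
    have h1 : q.valuation F (e : F) = 1 := by rw [valuation_eq_exp_ord, he]; simp
    refine le_antisymm (placeRing_valuation_algebraMap_le_one P hPq h1.le) ?_
    have h2 := placeRing_valuation_algebraMap_le_one P hPq (e := (e : F)⁻¹)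
      (by rw [map_inv₀, h1, inv_one])
    rw [map_inv₀, map_inv₀] at h2
    exact (inv_le_one₀ (zero_lt_iff.2 ((Valuation.ne_zero_iff _).2 (by simp)))).1 h2
  have hvy : (placeRing P).valuation y = 1 := by
    rw [← hy, map_pow] at hve
    exact (pow_eq_one_iff_of_nonneg zero_le hN).1 hve
  have hy0 : y ≠ 0 := by rintro rfl; simp at hvy
  have hvp : (placeRing P).valuation (p : L) = 1 := by
    refine le_antisymm ?_ (not_lt.1 fun h => hpq
      ((placeRing_valuation_algebraMap_lt_one_iff P hPq _).1 (by simpa using h)))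
    simp
  have h1 : σ y / y = 1 := by
    refine eq_one_of_valuation_sub_one_lt (placeRing P).valuation hp (n := n) ?_ ?_
    · rw [div_pow, ← map_pow, hy, map_algebraMap_of_tower, div_self (by simp)]
    · rw [div_sub_one hy0, map_div₀, hvy, div_one, hvp]
      exact placeRing_valuation_map_sub_lt_one P hσ hvy.le
  exact (div_eq_one_iff_eq hy0).1 h1

/-- The function `x ↦ a / x^N - 1` is continuous at `c` and vanishes there, and `F` is dense in
`F_q`. -/
theorem exists_valuation_div_sub_one_lt {a : F} {c : (q.adicCompletion F)ˣ} {N : ℕ}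
    (h : algebraMap F (q.adicCompletion F) a = c ^ N) {t : F} (ht : t ≠ 0) :
    ∃ b : F, b ≠ 0 ∧ q.valuation F (a / b ^ N - 1) < q.valuation F t := by
  have hcN : (c : q.adicCompletion F) ^ N ≠ 0 := pow_ne_zero N c.ne_zero
  have hcont : ContinuousAt (fun x : q.adicCompletion F => algebraMap F _ a / x ^ N - 1)
      (c : q.adicCompletion F) :=
    (continuousAt_const.div (continuousAt_id.pow N) hcN).sub continuousAt_const
  have h0 : (fun x : q.adicCompletion F => algebraMap F _ a / x ^ N - 1) c = 0 := by
    simp only [h, div_self hcN, sub_self]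
  have hball : {x : q.adicCompletion F | Valued.v x < Valued.v (algebraMap F (q.adicCompletion F) t)}
      ∈ nhds ((fun x : q.adicCompletion F => algebraMap F _ a / x ^ N - 1) c) := by
    rw [h0, Valued.mem_nhds_zero]
    have ht' : algebraMap F (q.adicCompletion F) t ≠ 0 := by simpa using ht
    refine ⟨Units.mk0 (Valued.v.restrict (algebraMap F (q.adicCompletion F) t))
      ((Valuation.ne_zero_iff _).2 ht'), fun x hx => ?_⟩
    exact (Valuation.restrict_lt_iff _).1 hx
  have hmem := Filter.inter_mem (hcont.preimage_mem_nhds hball) (isOpen_ne.mem_nhds c.ne_zero)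
  obtain ⟨_, ⟨hb, hb0⟩, b, rfl⟩ :=
    mem_closure_iff_nhds.1 (HeightOneSpectrum.denseRange_algebraMap F q c) _ hmem
  refine ⟨b, by rintro rfl; simp at hb0, ?_⟩
  rw [← q.valuedAdicCompletion_eq_valuation', ← q.valuedAdicCompletion_eq_valuation']
  have h1 : algebraMap F (q.adicCompletion F) (a / b ^ N - 1) =
      algebraMap F _ a / algebraMap F _ b ^ N - 1 := by
    rw [map_sub, map_div₀, map_pow, map_one]
  refine lt_of_eq_of_lt (congrArg Valued.v h1) hb

/-- Inertia acts trivially on `y ^ m` if `y ^ N ∈ F` and `y ^ (m * N)` is locally an `N`-th power,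
`N` being a power of `p`. -/
theorem map_pow_eq_self_of_eq_pow (hp : p.Prime)
    (hPq : P.comap (algebraMap (𝓞 F) (𝓞 L)) = q.asIdeal) (hσ : σ ∈ P.inertia (L ≃ₐ[K] L))
    {n m : ℕ} {ζ : K} (hζ : IsPrimitiveRoot ζ (p ^ n)) {a : Fˣ} {c : (q.adicCompletion F)ˣ}
    (hc : algebraMap F (q.adicCompletion F) a ^ m = c ^ p ^ n) {y : L}
    (hy : y ^ p ^ n = algebraMap F L a) : σ (y ^ m) = y ^ m := by
  have hN : p ^ n ≠ 0 := pow_ne_zero n hp.ne_zero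
  have : NeZero (p ^ n) := ⟨hN⟩
  set v := (placeRing P).valuation with hv
  obtain ⟨r, hrq, hr0⟩ := Submodule.exists_mem_ne_zero_of_ne_bot q.ne_bot
  have hr0' : (r : F) ≠ 0 := by exact_mod_cast hr0
  -- `t` is strictly smaller than `p` at `P`, and lies in `F`, so bounds by `v t` are preserved by
  -- `σ`.
  set t : F := p * r with ht
  have hp0 : (p : F) ≠ 0 := by exact_mod_cast hp.ne_zero
  have ht0 : t ≠ 0 := mul_ne_zero hp0 hr0'
  have hvt0 : v (algebraMap F L t) ≠ 0 := (Valuation.ne_zero_iff _).2 (by simpa using ht0)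
  have hvp0 : v (p : L) ≠ 0 := (Valuation.ne_zero_iff _).2 (by exact_mod_cast hp.ne_zero)
  have hvp1 : v (p : L) ≤ 1 := by simp [hv]
  have hvt : v (algebraMap F L t) < v (p : L) := by
    have h1 : v (algebraMap F L r) < 1 :=
      (placeRing_valuation_algebraMap_lt_one_iff P hPq r).2 hrq
    rw [ht, map_mul, map_mul, map_natCast]
    exact mul_lt_of_lt_one_right (zero_lt_iff.2 hvp0) h1
  obtain ⟨b, hb0, hb⟩ := exists_valuation_div_sub_one_lt (a := (a : F) ^ m) (c := c) (N := p ^ n)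
    (by rw [map_pow, hc]) (pow_ne_zero (p ^ n) ht0)
  have hbL : algebraMap F L b ≠ 0 := by simpa using hb0
  set z : L := y ^ m / algebraMap F L b with hz
  have hzN : z ^ p ^ n = algebraMap F L ((a : F) ^ m / b ^ p ^ n) := by
    rw [hz, div_pow, ← pow_mul, mul_comm, pow_mul, hy, map_div₀, map_pow, map_pow]
  have hclose : v (z ^ p ^ n - 1) ≤ v (algebraMap F L t) ^ p ^ n := by
    have h1 : q.valuation F (((a : F) ^ m / b ^ p ^ n - 1) / t ^ p ^ n) ≤ 1 := by
      rw [map_div₀]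
      exact div_le_one_of_le₀ hb.le zero_le
    have h2 := placeRing_valuation_algebraMap_le_one P hPq h1
    rw [map_div₀, map_div₀, map_sub, map_one, ← hzN, map_pow, map_pow] at h2
    exact (div_le_one₀ (zero_lt_iff.2 (pow_ne_zero _ hvt0))).1 h2
  obtain ⟨ξ, hξ, hzξ⟩ := exists_valuation_sub_le v
    (hζ.map_of_injective (algebraMap K L).injective) hclose
  have hvξ : v ξ = 1 := valuation_eq_one_of_pow_eq_one v hN hξ
  have hξ0 : ξ ≠ 0 := by rintro rfl; simp at hvξ
  have hσξ : σ ξ = ξ := by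
    obtain ⟨i, -, hi⟩ := (hζ.map_of_injective (algebraMap K L).injective).eq_pow_of_pow_eq_one hξ
    rw [← hi, ← map_pow, σ.commutes]
  set w : L := z / ξ with hw
  have hw1 : v (w - 1) ≤ v (algebraMap F L t) := by
    rwa [hw, div_sub_one hξ0, map_div₀, hvξ, div_one]
  have hvw : v w = 1 := by
    have : v (w - 1) < v 1 := by
      rw [map_one]
      exact hw1.trans_lt (hvt.trans_le hvp1)
    rw [← map_one v]
    exact Valuation.map_eq_of_sub_lt v this
  have hw0 : w ≠ 0 := by rintro h; simp [h] at hvw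
  have hσw1 : v (σ w - 1) ≤ v (algebraMap F L t) := by
    have h1 : v ((w - 1) / algebraMap F L t) ≤ 1 := by
      rw [map_div₀]
      exact div_le_one_of_le₀ hw1 zero_le
    have h2 := placeRing_valuation_map_le_one P hσ h1
    rw [map_div₀, map_algebraMap_of_tower, map_div₀, map_sub, map_one] at h2
    exact (div_le_one₀ (zero_lt_iff.2 hvt0)).1 h2
  -- Since `w ^ p^n` lies in `F`, this quotient is a `p^n`-th root of unity; `w` and `σ w` are both
  -- within `v t < v p` of `1`.
  have hσw : σ w / w = 1 := by
    refine eq_one_of_valuation_sub_one_lt v hp (n := n) ?_ ?_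
    · have h1 : w ^ p ^ n = algebraMap F L ((a : F) ^ m / b ^ p ^ n) := by
        rw [hw, div_pow, hξ, div_one, hzN]
      rw [div_pow, ← map_pow, h1, map_algebraMap_of_tower, div_self (by simp [hb0])]
    · rw [div_sub_one hw0, map_div₀, hvw, div_one]
      refine lt_of_le_of_lt ?_ hvt
      rw [← sub_sub_sub_cancel_right _ _ 1]
      exact v.map_sub_le hσw1 hw1
  have hσw' := (div_eq_one_iff_eq hw0).1 hσw
  have hyw : y ^ m = w * ξ * algebraMap F L b := by
    rw [hw, hz]
    field_simp
  rw [hyw, map_mul, map_mul, hσw', hσξ, map_algebraMap_of_tower]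

end Unramified

/-! ### Unramified Kummer extensions -/

section Kummer

variable {p : ℕ} {F : Type*} [Field F]

theorem exists_isPrimitiveRoot_cyclotomicTower [CharZero F] (hp : p.Prime) (n : ℕ) :
    ∃ ζ : cyclotomicTower p F, IsPrimitiveRoot ζ (p ^ n) := by
  have : NeZero ((p ^ n : ℕ) : AlgebraicClosure F) :=
    ⟨by exact_mod_cast pow_ne_zero n hp.ne_zero⟩
  obtain ⟨ζ, hζ⟩ := HasEnoughRootsOfUnity.exists_primitiveRoot (AlgebraicClosure F) (p ^ n)
  refine ⟨⟨ζ, IntermediateField.subset_adjoin F _ ⟨n, hζ.pow_eq_one⟩⟩, ?_⟩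
  exact IsPrimitiveRoot.of_map_of_injective (f := algebraMap (cyclotomicTower p F)
    (AlgebraicClosure F)) hζ (FaithfulSMul.algebraMap_injective _ _)

/-- An automorphism of `F_x` that fixes the radicals generating `F_x` is trivial. -/
theorem eq_one_of_forall_radical {x : PCompletion p Fˣ}
    {σ : kummerExtension p x ≃ₐ[cyclotomicTower p F] kummerExtension p x}
    (h : ∀ (n : ℕ) (a : Fˣ), IsLiftAt p x n a → ∀ y : kummerExtension p x,
      y ^ p ^ n = algebraMap F (kummerExtension p x) a → σ y = y) : σ = 1 := by
  have key : ∀ y : AlgebraicClosure F, ∀ hy : y ∈ kummerExtension p x, σ ⟨y, hy⟩ = ⟨y, hy⟩ := by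
    intro y hy
    induction hy using IntermediateField.adjoin_induction with
    | mem y hy' =>
      obtain ⟨n, a, ha, hya⟩ := hy'
      exact h n a ha _ (Subtype.ext hya)
    | algebraMap c => exact σ.commutes c
    | add y z hy hz h1 h2 =>
      have := congrArg₂ (· + ·) h1 h2
      simp only [← map_add] at this
      exact this
    | inv y hy h1 =>
      have := congrArg (·⁻¹) h1
      simp only [← map_inv₀] at this
      exact this
    | mul y z hy hz h1 h2 =>
      have := congrArg₂ (· * ·) h1 h2
      simp only [← map_mul] at this
      exact this
  exact AlgEquiv.ext fun y => key y y.2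

variable [NumberField F] [Fact p.Prime] {x : PCompletion p Fˣ} {q : HeightOneSpectrum (𝓞 F)}

instance : Algebra.IsAlgebraic ℚ (AlgebraicClosure F) := Algebra.IsAlgebraic.trans ℚ F _

instance : Algebra.IsAlgebraic ℚ (kummerExtension p x) :=
  Algebra.IsAlgebraic.of_injective
    ((algebraMap (kummerExtension p x) (AlgebraicClosure F)).toRatAlgHom) (RingHom.injective _)

/-- Two `p^n`-th roots of the same element differ by a root of unity of the cyclotomic tower, so
checking one root suffices. -/
theorem map_eq_self_of_pow_eq {L : Type*} [Field L] [Algebra F L]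
    [Algebra (cyclotomicTower p F) L] [IsScalarTower F (cyclotomicTower p F) L]
    (σ : L ≃ₐ[cyclotomicTower p F] L) {n : ℕ} {y z : L} (h : y ^ p ^ n = z ^ p ^ n)
    (hz : σ z = z) : σ y = y := by
  have hp : p.Prime := Fact.out
  have hN : p ^ n ≠ 0 := pow_ne_zero n hp.ne_zero
  have : NeZero (p ^ n) := ⟨hN⟩
  by_cases hz0 : z = 0
  · have : y = 0 := by
      rw [hz0, zero_pow hN] at h
      exact (pow_eq_zero_iff hN).1 h
    rw [this, map_zero]
  obtain ⟨ζ, hζ⟩ := exists_isPrimitiveRoot_cyclotomicTower (F := F) hp n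
  obtain ⟨i, -, hi⟩ := (hζ.map_of_injective
    (algebraMap (cyclotomicTower p F) L).injective).eq_pow_of_pow_eq_one (ξ := y / z)
    (by rw [div_pow, h, div_self (pow_ne_zero _ hz0)])
  rw [eq_div_iff hz0] at hi
  rw [← hi, map_mul, hz, ← map_pow, σ.commutes]

theorem unramifiedAbove_of_isOfFinAddOrder (h : IsOfFinAddOrder (loc p q x)) :
    UnramifiedAbove (cyclotomicTower p F) (kummerExtension p x) q := by
  have hp : p.Prime := Fact.out
  intro P hP hPq
  rw [eq_bot_iff]
  intro σ hσ
  rw [Subgroup.mem_bot]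
  obtain ⟨k, hk⟩ := isOfFinAddOrder_iff_exists_pow.1 h
  refine eq_one_of_forall_radical fun n a ha y hy => ?_
  -- Torsion costs a factor `p^k`: a `p^(n+k)`-th root `z` of a lift at level `n + k` has its power
  -- `z^(p^k)` fixed by inertia, and this power is a `p^n`-th root of `b`.
  obtain ⟨b, hb⟩ := exists_isLiftAt x (n + k)
  obtain ⟨c, hc⟩ := hk (n + k) _ (hb.map _)
  obtain ⟨d, hd⟩ := ha.exists_eq_mul_pow (hb.mono (n.le_add_right k))
  obtain ⟨ζ, hζ⟩ := exists_isPrimitiveRoot_cyclotomicTower (F := F) hp (n + k)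
  obtain ⟨z, hz⟩ := IsAlgClosed.exists_pow_nat_eq
    (algebraMap F (AlgebraicClosure F) b) (n := p ^ (n + k)) (pow_pos hp.pos _)
  let z' : kummerExtension p x := ⟨z, IntermediateField.subset_adjoin _ _ ⟨n + k, b, hb, hz⟩⟩
  have hz' : z' ^ p ^ (n + k) = algebraMap F (kummerExtension p x) b := Subtype.ext hz
  have h1 : σ (z' ^ p ^ k) = z' ^ p ^ k :=
    map_pow_eq_self_of_eq_pow P hp hPq hσ hζ (congrArg Units.val hc) hz'
  refine map_eq_self_of_pow_eq (p := p) (F := F) σ (n := n)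
    (z := z' ^ p ^ k * algebraMap F _ (d : F)) ?_ ?_
  · rw [hy, hd, Units.val_mul, map_mul, mul_pow, ← pow_mul, ← pow_add, add_comm k n, hz',
      Units.val_pow_eq_pow_val, map_pow]
  · rw [map_mul, h1, map_algebraMap_of_tower]

theorem unramifiedAbove_of_mem_completedQUnits {Q : Finset (HeightOneSpectrum (𝓞 F))}
    (hx : x ∈ completedQUnits p Q) (hq : q ∉ Q) (hpq : (p : 𝓞 F) ∉ q.asIdeal) :
    UnramifiedAbove (cyclotomicTower p F) (kummerExtension p x) q := by
  have hp : p.Prime := Fact.out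
  intro P hP hPq
  rw [eq_bot_iff]
  intro σ hσ
  rw [Subgroup.mem_bot]
  refine eq_one_of_forall_radical fun n a ha y hy => ?_
  obtain ⟨e, he, hl⟩ := exists_mem_qUnits_isLiftAt_of_mem hx n
  obtain ⟨d, hd⟩ := ha.exists_eq_mul_pow hl
  have hd0 : algebraMap F (kummerExtension p x) d ≠ 0 := by simp
  have h1 : σ (y / algebraMap F _ (d : F)) = y / algebraMap F _ (d : F) := by
    refine map_eq_self_of_ord_eq_zero P hp hPq hσ hpq (mem_qUnits_iff.1 he q hq) (n := n) ?_
    rw [div_pow, hy, hd, div_eq_iff (pow_ne_zero _ hd0), Units.val_mul, map_mul,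
      Units.val_pow_eq_pow_val, map_pow]
  rw [map_div₀, map_algebraMap_of_tower] at h1
  exact (div_left_inj' hd0).1 h1

end Kummer

/-! ### Roots of unity in the completion -/

section LocalRoots

variable {F : Type*} [Field F] [NumberField F] (q : HeightOneSpectrum (𝓞 F))

instance charZero_adicCompletion : CharZero (q.adicCompletion F) :=
  charZero_of_injective_algebraMap (algebraMap F (q.adicCompletion F)).injective

theorem valued_algebraMap (a : F) :
    Valued.v (algebraMap F (q.adicCompletion F) a) = q.valuation F a :=
  q.valuedAdicCompletion_eq_valuation' a

/-- A nearby element of `F` is itself `q`-integral, hence can in turn be approximated by an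
algebraic integer. -/
theorem exists_integer_valued_sub_lt {t : F} (ht : t ≠ 0) (ht1 : q.valuation F t ≤ 1)
    {x : q.adicCompletion F} (hx : Valued.v x ≤ 1) :
    ∃ b : 𝓞 F, Valued.v (x - algebraMap F (q.adicCompletion F) b) < q.valuation F t := by
  have ht' : algebraMap F (q.adicCompletion F) t ≠ 0 := by simpa using ht
  have hball : {y : q.adicCompletion F | Valued.v (y - x) <
      Valued.v (algebraMap F (q.adicCompletion F) t)} ∈ nhds x := by
    rw [Valued.mem_nhds]
    refine ⟨Units.mk0 (Valued.v.restrict (algebraMap F (q.adicCompletion F) t))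
      ((Valuation.ne_zero_iff _).2 ht'), fun y hy => ?_⟩
    exact (Valuation.restrict_lt_iff _).1 hy
  obtain ⟨_, hc, c, rfl⟩ :=
    mem_closure_iff_nhds.1 (HeightOneSpectrum.denseRange_algebraMap F q x) _ hball
  have hc' : Valued.v (algebraMap F (q.adicCompletion F) c - x) < q.valuation F t := by
    rw [← valued_algebraMap]
    exact hc
  have hc1 : q.valuation F c ≤ 1 := by
    rw [← valued_algebraMap, ← sub_add_cancel (algebraMap F (q.adicCompletion F) c) x]
    exact Valued.v.map_add_le (hc'.le.trans ht1) hx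
  obtain ⟨b, hb⟩ := q.exists_valuation_sub_lt_of_integer hc1
    (Units.mk0 (q.valuation F t) ((Valuation.ne_zero_iff _).2 ht))
  refine ⟨b, ?_⟩
  rw [← neg_sub, Valuation.map_neg, ← sub_add_sub_cancel _ (algebraMap F (q.adicCompletion F) c)]
  refine Valued.v.map_add_lt ?_ hc'
  rw [← map_sub, valued_algebraMap]
  exact hb

/-- The completion does not contain all the roots of unity of `p`-power order. -/
theorem exists_forall_not_isPrimitiveRoot {p : ℕ} (hp : p.Prime) :
    ∃ n, ∀ ζ : q.adicCompletion F, ¬ IsPrimitiveRoot ζ (p ^ n) := by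
  by_contra! hcon
  choose ζ hζ using hcon
  obtain ⟨r, hrq, hr0⟩ := Submodule.exists_mem_ne_zero_of_ne_bot q.ne_bot
  set t : 𝓞 F := p * r with ht
  have hp0 : (p : 𝓞 F) ≠ 0 := by exact_mod_cast hp.ne_zero
  have ht0 : t ≠ 0 := mul_ne_zero hp0 hr0
  have htF : (t : F) ≠ 0 := by exact_mod_cast ht0
  have hvt1 : q.valuation F (t : F) ≤ 1 := q.valuation_le_one t
  have hvt : q.valuation F (t : F) < Valued.v (p : q.adicCompletion F) := by
    have h1 : q.valuation F (algebraMap (𝓞 F) F r) < 1 := (q.valuation_lt_one_iff_mem r).2 hrq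
    have h2 : q.valuation F (p : F) ≠ 0 :=
      (Valuation.ne_zero_iff _).2 (by exact_mod_cast hp.ne_zero)
    have h3 : (t : F) = p * algebraMap (𝓞 F) F r :=
      (map_mul (algebraMap (𝓞 F) F) _ _).trans (by rw [map_natCast])
    rw [← map_natCast (algebraMap F (q.adicCompletion F)), valued_algebraMap, h3, map_mul]
    exact mul_lt_of_lt_one_right (zero_lt_iff.2 h2) h1
  have hvζ : ∀ n, Valued.v (ζ n) = 1 := fun n =>
    valuation_eq_one_of_pow_eq_one _ (pow_ne_zero n hp.ne_zero) (hζ n).pow_eq_one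
  choose b hb using fun n => exists_integer_valued_sub_lt q htF hvt1 (hvζ n).le
  have : Finite (𝓞 F ⧸ Ideal.span {t}) :=
    Ideal.finiteQuotientOfFreeOfNeBot _ (by simpa using ht0)
  -- Pigeonhole modulo `t`: two roots of unity of different orders come closer than `v p`, so their
  -- quotient would be `1`.
  obtain ⟨n, m, hnm, h⟩ := Finite.exists_ne_map_eq_of_infinite
    (fun n => Ideal.Quotient.mk (Ideal.span {t}) (b n))
  rw [Ideal.Quotient.mk_eq_mk_iff_sub_mem, Ideal.mem_span_singleton] at h
  have hbb : Valued.v (algebraMap F (q.adicCompletion F) (b n) -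
      algebraMap F (q.adicCompletion F) (b m)) ≤ q.valuation F (t : F) := by
    obtain ⟨s, hs⟩ := h
    rw [← map_sub, valued_algebraMap, ← map_sub, hs, map_mul, map_mul]
    exact mul_le_of_le_one_right' (q.valuation_le_one s)
  have hlt : Valued.v (ζ n - ζ m) < Valued.v (p : q.adicCompletion F) := by
    have h1 : ζ n - ζ m = (ζ n - algebraMap F (q.adicCompletion F) (b n)) +
        (algebraMap F (q.adicCompletion F) (b n) - algebraMap F (q.adicCompletion F) (b m)) -
        (ζ m - algebraMap F (q.adicCompletion F) (b m)) := by ring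
    rw [h1]
    exact lt_of_le_of_lt (Valued.v.map_sub_le (Valued.v.map_add_le (hb n).le hbb) (hb m).le) hvt
  have hζm : ζ m ≠ 0 := (hζ m).ne_zero (pow_ne_zero m hp.ne_zero)
  have heq : ζ n / ζ m = 1 := by
    refine eq_one_of_valuation_sub_one_lt Valued.v hp (n := n + m) ?_ ?_
    · rw [div_pow, pow_add, pow_mul, (hζ n).pow_eq_one, mul_comm, pow_mul, (hζ m).pow_eq_one,
        one_pow, one_pow, div_one]
    · rwa [div_sub_one hζm, map_div₀, hvζ, div_one]
  have heq' := (hζ n).unique (((div_eq_one_iff_eq hζm).1 heq) ▸ hζ m)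
  exact hnm (Nat.pow_right_injective hp.two_le heq')

end LocalRoots

/-! ### The prime defined by an embedding into the algebraic closure of the completion -/

/-- `a` lies in the number field `F(a)`, whose residue ring at the contraction of `P` is finite, so
two powers of `a` agree there. Nonzero residues are thus roots of unity, even when `L` is infinite
over `F`. -/
theorem exists_quotient_mk_pow_eq_one {F L : Type*} [Field F] [NumberField F] [Field L]
    [Algebra F L] [Algebra.IsAlgebraic F L] {q : HeightOneSpectrum (𝓞 F)} (P : Ideal (𝓞 L))
    [P.IsPrime] (hPq : P.comap (algebraMap (𝓞 F) (𝓞 L)) = q.asIdeal) {a : 𝓞 L} (ha : a ∉ P) :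
    ∃ m ≠ 0, Ideal.Quotient.mk P a ^ m = 1 := by
  let E := IntermediateField.adjoin F {(a : L)}
  have : FiniteDimensional F E := IntermediateField.adjoin.finiteDimensional
    (Algebra.IsAlgebraic.isAlgebraic (a : L)).isIntegral
  have : NumberField E := NumberField.of_module_finite F E
  let f := algebraMap (𝓞 E) (𝓞 L)
  have haE : IsIntegral ℤ (⟨a, IntermediateField.mem_adjoin_simple_self F (a : L)⟩ : E) :=
    (isIntegral_algebraMap_iff (algebraMap E L).injective).1 a.isIntegral_coe
  let e : 𝓞 E := ⟨_, haE⟩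
  have he : f e = a := RingOfIntegers.ext rfl
  obtain ⟨r, hrq, hr0⟩ := Submodule.exists_mem_ne_zero_of_ne_bot q.ne_bot
  have hI : P.comap f ≠ ⊥ := by
    intro h
    have h1 : algebraMap (𝓞 F) (𝓞 E) r ∈ P.comap f := by
      rw [← hPq] at hrq
      exact hrq
    rw [h, Ideal.mem_bot] at h1
    exact hr0 ((FaithfulSMul.algebraMap_injective (𝓞 F) (𝓞 E)) (by rw [h1, map_zero]))
  have : Finite (𝓞 E ⧸ P.comap f) := Ideal.finiteQuotientOfFreeOfNeBot _ hI
  have hne : Ideal.Quotient.mk P a ≠ 0 := fun h => ha (Ideal.Quotient.eq_zero_iff_mem.1 h)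
  have key : ∀ i j : ℕ, i < j → Ideal.Quotient.mk (P.comap f) (e ^ i) =
      Ideal.Quotient.mk (P.comap f) (e ^ j) → ∃ m ≠ 0, Ideal.Quotient.mk P a ^ m = 1 := by
    intro i j hij h
    refine ⟨j - i, by omega, ?_⟩
    have h1 : Ideal.Quotient.mk P (f (e ^ i)) = Ideal.Quotient.mk P (f (e ^ j)) := by
      rw [Ideal.Quotient.mk_eq_mk_iff_sub_mem] at h ⊢
      rw [← map_sub]
      exact h
    rw [map_pow, map_pow, map_pow, map_pow, he, ← Nat.sub_add_cancel hij.le, pow_add] at h1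
    exact (mul_eq_right₀ (pow_ne_zero i hne)).1 h1.symm
  obtain ⟨i, j, hij, h⟩ := Finite.exists_ne_map_eq_of_infinite
    (fun i => Ideal.Quotient.mk (P.comap f) (e ^ i))
  rcases lt_or_gt_of_ne hij with h' | h'
  · exact key i j h' h
  · exact key j i h' h.symm

section LocalPrime

variable {F : Type*} [Field F] [NumberField F] {q : HeightOneSpectrum (𝓞 F)}

/-- The completion as a nontrivially normed field. -/
abbrev completionNormedField (q : HeightOneSpectrum (𝓞 F)) :
    NontriviallyNormedField (q.adicCompletion F) :=
  { (inferInstance : NormedField (q.adicCompletion F)) with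
    non_trivial := by
      obtain ⟨r, hrq, hr0⟩ := Submodule.exists_mem_ne_zero_of_ne_bot q.ne_bot
      have h1 := (FinitePlace.norm_lt_one_iff_mem F q r).2 hrq
      refine ⟨(FinitePlace.embedding q (algebraMap (𝓞 F) F r))⁻¹, ?_⟩
      rw [norm_inv]
      refine (one_lt_inv₀ (norm_pos_iff.2 ?_)).2 h1
      simpa using hr0 }

attribute [local instance] completionNormedField

/-- The extension of the `q`-adic absolute value to the algebraic closure of the completion. -/
def extNorm (q : HeightOneSpectrum (𝓞 F)) :
    MulAlgebraNorm (q.adicCompletion F) (AlgebraicClosure (q.adicCompletion F)) :=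
  spectralMulAlgNorm _ _

theorem extNorm_algebraMap (a : q.adicCompletion F) : extNorm q (algebraMap _ _ a) = ‖a‖ :=
  spectralNorm_extends a

theorem extNorm_add_le_max (a b : AlgebraicClosure (q.adicCompletion F)) :
    extNorm q (a + b) ≤ max (extNorm q a) (extNorm q b) :=
  isNonarchimedean_spectralNorm a b

theorem extNorm_map (σ : Gal(AlgebraicClosure (q.adicCompletion F)/q.adicCompletion F))
    (a : AlgebraicClosure (q.adicCompletion F)) : extNorm q (σ a) = extNorm q a :=
  (spectralNorm_eq_of_equiv σ a).symm

end LocalPrime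

section LocalPrime

variable {F : Type*} [Field F] [NumberField F] {q : HeightOneSpectrum (𝓞 F)}
  (ι : AlgebraicClosure F →ₐ[F] AlgebraicClosure (q.adicCompletion F))

theorem extNorm_integer_le_one (a : 𝓞 (AlgebraicClosure F)) : extNorm q (ι a) ≤ 1 := by
  let v : Valuation (AlgebraicClosure (q.adicCompletion F)) NNReal :=
    { toFun := fun z => ⟨extNorm q z, apply_nonneg _ _⟩
      map_zero' := NNReal.eq (map_zero (extNorm q))
      map_one' := NNReal.eq (map_one (extNorm q))
      map_mul' := fun z w => NNReal.eq (map_mul (extNorm q) z w)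
      map_add_le_max' := fun z w => extNorm_add_le_max z w }
  have h : IsIntegral ℤ (ι (a : AlgebraicClosure F)) :=
    a.isIntegral_coe.map (ι.restrictScalars ℤ)
  exact (Valuation.integer.integers v).mem_of_integral h.tower_top

/-- The prime of the integral closure of `ℤ` in `F̄` defined by an embedding of `F̄` into the
algebraic closure of the completion `F_q`. -/
def residuePrime : Ideal (𝓞 (AlgebraicClosure F)) where
  carrier := {a | extNorm q (ι a) < 1}
  add_mem' {a b} ha hb := by
    change extNorm q (ι ((a : AlgebraicClosure F) + b)) < 1
    rw [map_add]
    exact (extNorm_add_le_max _ _).trans_lt (max_lt ha hb)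
  zero_mem' := by
    change extNorm q (ι 0) < 1
    rw [map_zero, map_zero]
    exact one_pos
  smul_mem' c a ha := by
    change extNorm q (ι ((c : AlgebraicClosure F) * a)) < 1
    rw [map_mul, map_mul]
    exact mul_lt_one_of_nonneg_of_lt_one_right (extNorm_integer_le_one ι c) (apply_nonneg _ _) ha

theorem mem_residuePrime {a : 𝓞 (AlgebraicClosure F)} :
    a ∈ residuePrime ι ↔ extNorm q (ι a) < 1 := Iff.rfl

instance : (residuePrime ι).IsPrime where
  ne_top' h := by
    have h1 : (1 : 𝓞 (AlgebraicClosure F)) ∈ residuePrime ι := h ▸ Submodule.mem_top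
    rw [mem_residuePrime] at h1
    simp at h1
  mem_or_mem' {a b} h := by
    by_contra! hcon
    rw [mem_residuePrime, mem_residuePrime, not_lt, not_lt] at hcon
    have h1 : extNorm q (ι ((a : AlgebraicClosure F) * b)) < 1 := h
    rw [map_mul, map_mul] at h1
    exact absurd h1 (not_lt.2 (one_le_mul_of_one_le_of_one_le hcon.1 hcon.2))

theorem comap_residuePrime :
    (residuePrime ι).comap (algebraMap (𝓞 F) (𝓞 (AlgebraicClosure F))) = q.asIdeal := by
  ext a
  rw [Ideal.mem_comap, mem_residuePrime, ← FinitePlace.norm_lt_one_iff_mem F q, ← extNorm_algebraMap]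
  have h : ι (algebraMap F (AlgebraicClosure F) a) =
    algebraMap (q.adicCompletion F) _ (algebraMap F (q.adicCompletion F) a) := by
    rw [ι.commutes, IsScalarTower.algebraMap_apply F (q.adicCompletion F)]
  exact iff_of_eq (congrArg (fun z => extNorm q z < 1) h)

/-- Every automorphism of the algebraic closure of `F_q` restricts to `F̄`. -/
theorem exists_restrict (σ : Gal(AlgebraicClosure (q.adicCompletion F)/q.adicCompletion F)) :
    ∃ s : Gal(AlgebraicClosure F/F), ∀ y, ι (s y) = σ (ι y) := by
  let _ : Algebra (AlgebraicClosure F) (AlgebraicClosure (q.adicCompletion F)) :=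
    ι.toRingHom.toAlgebra
  have : IsScalarTower F (AlgebraicClosure F) (AlgebraicClosure (q.adicCompletion F)) :=
    IsScalarTower.of_algebraMap_eq fun a => (ι.commutes a).symm
  exact ⟨(σ.restrictScalars F).restrictNormal (AlgebraicClosure F),
    (σ.restrictScalars F).restrictNormal_commutes (AlgebraicClosure F)⟩

/-! ### Commutators in the decomposition group -/

variable {ι} {σ τ : Gal(AlgebraicClosure (q.adicCompletion F)/q.adicCompletion F)}
  {s t : Gal(AlgebraicClosure F/F)}

theorem smul_mem_residuePrime (hs : ∀ y, ι (s y) = σ (ι y)) {a : 𝓞 (AlgebraicClosure F)} :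
    s • a ∈ residuePrime ι ↔ a ∈ residuePrime ι := by
  rw [mem_residuePrime, mem_residuePrime]
  have h : ι (s • a : 𝓞 (AlgebraicClosure F)) = σ (ι a) := hs a
  rw [h, extNorm_map]

/-- Elements of the decomposition group commute in their action on the residue field. -/
theorem smul_smul_sub_mem_residuePrime (hs : ∀ y, ι (s y) = σ (ι y))
    (ht : ∀ y, ι (t y) = τ (ι y)) (a : 𝓞 (AlgebraicClosure F)) :
    s • t • a - t • s • a ∈ residuePrime ι := by
  by_cases ha : a ∈ residuePrime ι
  · exact sub_mem ((smul_mem_residuePrime hs).2 ((smul_mem_residuePrime ht).2 ha))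
      ((smul_mem_residuePrime ht).2 ((smul_mem_residuePrime hs).2 ha))
  obtain ⟨m, hm, h⟩ := exists_quotient_mk_pow_eq_one _ (comap_residuePrime ι) ha
  let f : ∀ u : Gal(AlgebraicClosure F/F), 𝓞 (AlgebraicClosure F) →+* 𝓞 (AlgebraicClosure F) :=
    fun u => MulSemiringAction.toRingHom _ _ u
  have hf : ∀ {u : Gal(AlgebraicClosure F/F)}
      {ρ : Gal(AlgebraicClosure (q.adicCompletion F)/q.adicCompletion F)},
      (∀ y, ι (u y) = ρ (ι y)) → residuePrime ι ≤ (residuePrime ι).comap (f u) :=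
    fun hu _ hb => (smul_mem_residuePrime hu).2 hb
  have h1 := map_comm_of_pow_eq_one hm h
    (Ideal.quotientMap (residuePrime ι) (f s) (hf hs)).toMonoidHom
    (Ideal.quotientMap (residuePrime ι) (f t) (hf ht)).toMonoidHom
  exact Ideal.Quotient.eq.1 h1

variable {p : ℕ}

theorem map_map_eq_of_mem_cyclotomicTower (hp : p.Prime) (s t : Gal(AlgebraicClosure F/F))
    {y : AlgebraicClosure F} (hy : y ∈ cyclotomicTower p F) : s (t y) = t (s y) := by
  induction hy using IntermediateField.adjoin_induction with
  | mem y hy =>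
    obtain ⟨n, hn⟩ := hy
    exact map_comm_of_pow_eq_one (pow_ne_zero n hp.ne_zero) hn
      (s : AlgebraicClosure F →* AlgebraicClosure F) (t : AlgebraicClosure F →* AlgebraicClosure F)
  | algebraMap c => simp
  | add y z hy hz h1 h2 => simp only [map_add, h1, h2]
  | inv y hy h1 => simp only [map_inv₀, h1]
  | mul y z hy hz h1 h2 => simp only [map_mul, h1, h2]

instance (x : PCompletion p Fˣ) : Normal (cyclotomicTower p F) (kummerExtension p x) := by
  have : Normal (cyclotomicTower p F) (AlgebraicClosure F) :=
    Normal.tower_top_of_normal F (cyclotomicTower p F) (AlgebraicClosure F)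
  rw [IntermediateField.normal_iff_forall_map_le]
  intro ρ
  rw [kummerExtension, IntermediateField.adjoin_map]
  refine IntermediateField.adjoin.mono _ _ _ ?_
  rintro _ ⟨y, ⟨n, a, ha, hy⟩, rfl⟩
  refine ⟨n, a, ha, ?_⟩
  rw [← map_pow, hy, IsScalarTower.algebraMap_apply F (cyclotomicTower p F), ρ.commutes]

/-- If `F_x / F(μ_{p^∞})` is unramified above `q`, then the decomposition group acts on `F_x` through
an abelian quotient. -/
theorem map_map_eq_of_unramifiedAbove (hp : p.Prime) {x : PCompletion p Fˣ}
    (h : UnramifiedAbove (cyclotomicTower p F) (kummerExtension p x) q)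
    (ι : AlgebraicClosure F →ₐ[F] AlgebraicClosure (q.adicCompletion F))
    (σ τ : Gal(AlgebraicClosure (q.adicCompletion F)/q.adicCompletion F)) {y : AlgebraicClosure F}
    (hy : y ∈ kummerExtension p x) : σ (τ (ι y)) = τ (σ (ι y)) := by
  obtain ⟨s, hs⟩ := exists_restrict ι σ
  obtain ⟨t, ht⟩ := exists_restrict ι τ
  have hfix : ∀ z, (t * s) (((t * s)⁻¹ * (s * t)) z) = s (t z) := fun z => by
    rw [← AlgEquiv.mul_apply, mul_inv_cancel_left, AlgEquiv.mul_apply]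
  -- The commutator of `s` and `t` fixes the cyclotomic tower, whose Galois group over `F` is
  -- abelian.
  let ρ : Gal(AlgebraicClosure F/cyclotomicTower p F) :=
    { ((t * s)⁻¹ * (s * t) : Gal(AlgebraicClosure F/F)) with
      commutes' := fun z => (t * s).injective ((hfix z).trans
        (map_map_eq_of_mem_cyclotomicTower hp s t z.2)) }
  have hρ : ∀ z, t (s (ρ z)) = s (t z) := hfix
  let f := algebraMap (𝓞 (kummerExtension p x)) (𝓞 (AlgebraicClosure F))
  have hmem : ρ.restrictNormal (kummerExtension p x) ∈ ((residuePrime ι).comap f).inertia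
      (kummerExtension p x ≃ₐ[cyclotomicTower p F] kummerExtension p x) := by
    intro a
    change f (ρ.restrictNormal (kummerExtension p x) • a - a) ∈ residuePrime ι
    -- Applying `t s`, which preserves the prime, turns `ρ a - a` into `s t a - t s a`.
    rw [← smul_mem_residuePrime hs, ← smul_mem_residuePrime ht]
    convert smul_smul_sub_mem_residuePrime hs ht (f a) using 1
    rw [map_sub, smul_sub, smul_sub]
    congr 1
    refine RingOfIntegers.ext ?_
    change t (s (algebraMap (kummerExtension p x) (AlgebraicClosure F)
      (ρ.restrictNormal (kummerExtension p x) a))) = s (t (algebraMap _ _ (a : kummerExtension p x)))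
    rw [AlgEquiv.restrictNormal_commutes, hρ]
  have h1 := h ((residuePrime ι).comap f) inferInstance (by
    rw [← comap_residuePrime ι, Ideal.comap_comap]
    rfl)
  rw [h1, Subgroup.mem_bot] at hmem
  have h2 : ρ y = y := by
    have := ρ.restrictNormal_commutes (kummerExtension p x) ⟨y, hy⟩
    rw [hmem] at this
    exact this.symm
  rw [← ht, ← hs, ← hs, ← ht, ← hρ y, h2]

/-- Some automorphism acts nontrivially on roots of unity of `p`-power order. -/
theorem exists_map_ne (hp : p.Prime) (q : HeightOneSpectrum (𝓞 F)) :
    ∃ (r : ℕ) (τ : Gal(AlgebraicClosure (q.adicCompletion F)/q.adicCompletion F))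
      (ζ : AlgebraicClosure (q.adicCompletion F)), ζ ^ p ^ r = 1 ∧ τ ζ ≠ ζ := by
  obtain ⟨r, hr⟩ := exists_forall_not_isPrimitiveRoot q hp
  have : NeZero ((p ^ r : ℕ) : AlgebraicClosure (q.adicCompletion F)) :=
    ⟨by exact_mod_cast pow_ne_zero r hp.ne_zero⟩
  obtain ⟨ζ, hζ⟩ := HasEnoughRootsOfUnity.exists_primitiveRoot
    (AlgebraicClosure (q.adicCompletion F)) (p ^ r)
  by_contra! hcon
  obtain ⟨z, hz⟩ := IntermediateField.mem_bot.1 ((InfiniteGalois.mem_bot_iff_fixed ζ).2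
    fun τ => hcon r τ ζ hζ.pow_eq_one)
  rw [← hz] at hζ
  exact hr z (hζ.of_map_of_injective (FaithfulSMul.algebraMap_injective _ _))

theorem isOfFinAddOrder_loc_of_unramifiedAbove [Fact p.Prime] {x : PCompletion p Fˣ}
    (h : UnramifiedAbove (cyclotomicTower p F) (kummerExtension p x) q) :
    IsOfFinAddOrder (loc p q x) := by
  have hp : p.Prime := Fact.out
  obtain ⟨r, τ, ξ, hξ, hτξ⟩ := exists_map_ne hp q
  let ι : AlgebraicClosure F →ₐ[F] AlgebraicClosure (q.adicCompletion F) := IsAlgClosed.lift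
  refine isOfFinAddOrder_iff_exists_pow.2 ⟨r, fun n a' ha' => ?_⟩
  obtain ⟨a, ha⟩ := exists_isLiftAt x n
  obtain ⟨e, rfl⟩ := ha'.exists_eq_mul_pow (ha.map _)
  set a₁ := Units.map (algebraMap F (q.adicCompletion F)).toMonoidHom a with ha₁
  suffices hc : ∃ c : (q.adicCompletion F)ˣ, a₁ ^ p ^ r = c ^ p ^ n by
    obtain ⟨c, hc⟩ := hc
    exact ⟨c * e ^ p ^ r, by rw [mul_pow, mul_pow, hc, ← pow_mul, ← pow_mul, mul_comm (p ^ n)]⟩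
  rcases le_total n r with hnr | hnr
  · exact ⟨a₁ ^ p ^ (r - n), by rw [← pow_mul, ← pow_add, Nat.sub_add_cancel hnr]⟩
  have hN : NeZero ((p ^ n : ℕ) : AlgebraicClosure (q.adicCompletion F)) :=
    ⟨by exact_mod_cast pow_ne_zero n hp.ne_zero⟩
  have : NeZero (p ^ n) := ⟨pow_ne_zero n hp.ne_zero⟩
  obtain ⟨ζ, hζ⟩ := HasEnoughRootsOfUnity.exists_primitiveRoot
    (AlgebraicClosure (q.adicCompletion F)) (p ^ n)
  obtain ⟨c₀, -, hc₀⟩ := hζ.eq_pow_of_pow_eq_one (ξ := τ ζ)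
    (by rw [← map_pow, hζ.pow_eq_one, map_one])
  obtain ⟨c, hc⟩ : ∃ c, τ ζ = ζ ^ (c + 1) := by
    -- Adding `p^n` leaves the action on `ζ` unchanged and keeps the subtraction from truncating.
    refine ⟨c₀ + p ^ n - 1, ?_⟩
    rw [Nat.sub_add_cancel (by have := pow_pos hp.pos n; omega), pow_add, hζ.pow_eq_one, mul_one, hc₀]
  have hτ : ∀ ω, ω ^ p ^ n = 1 → τ ω = ω ^ (c + 1) := by
    intro ω hω
    obtain ⟨i, -, rfl⟩ := hζ.eq_pow_of_pow_eq_one hω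
    rw [map_pow, hc, ← pow_mul, ← pow_mul, mul_comm]
  -- If a higher power of `p` divided `c`, then `τ` would fix `ξ`.
  have hgcd : c.gcd (p ^ n) ∣ p ^ r := by
    obtain ⟨j, hj, hgj⟩ := (Nat.dvd_prime_pow hp).1 (Nat.gcd_dvd_right c (p ^ n))
    rw [hgj]
    refine pow_dvd_pow p (not_lt.1 fun hrj => hτξ ?_)
    have hξn : ξ ^ p ^ n = 1 := by
      rw [← Nat.add_sub_cancel' hnr, pow_add, pow_mul, hξ, one_pow]
    obtain ⟨d, hd⟩ : p ^ r ∣ c :=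
      ((pow_dvd_pow p hrj.le).trans (hgj ▸ dvd_refl _)).trans (Nat.gcd_dvd_left c (p ^ n))
    rw [hτ ξ hξn, hd, pow_succ, pow_mul, hξ, one_pow, one_mul]
  obtain ⟨y, hy⟩ := IsAlgClosed.exists_pow_nat_eq
    (algebraMap F (AlgebraicClosure F) a) (n := p ^ n) (pow_pos hp.pos _)
  have hyL : y ∈ kummerExtension p x := IntermediateField.subset_adjoin _ _ ⟨n, a, ha, hy⟩
  set Y := ι y with hYdef
  have hY : Y ^ p ^ n = algebraMap (q.adicCompletion F) _ (a₁ : q.adicCompletion F) := by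
    rw [hYdef, ← map_pow, hy, ι.commutes, IsScalarTower.algebraMap_apply F (q.adicCompletion F)]
    rfl
  have hY0 : Y ≠ 0 := by
    intro h0
    rw [h0, zero_pow (pow_ne_zero n hp.ne_zero)] at hY
    exact a₁.ne_zero ((FaithfulSMul.algebraMap_injective _ _) (by rw [← hY, map_zero]))
  have hτY0 : τ Y ≠ 0 := by simpa using hY0
  -- `σ Y / Y` is a `p^n`-th root of unity, so `τ` raises it to the power `c + 1`; with `τ σ Y = σ τ
  -- Y` this is exactly the claimed invariance.
  have hfix : ∀ σ : Gal(AlgebraicClosure (q.adicCompletion F)/q.adicCompletion F),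
      σ (Y ^ (c + 1) / τ Y) = Y ^ (c + 1) / τ Y := by
    intro σ
    have hω : (σ Y / Y) ^ p ^ n = 1 := by
      rw [div_pow, ← map_pow, hY, σ.commutes, div_self]
      rw [← hY]
      exact pow_ne_zero _ hY0
    have h1 := hτ _ hω
    rw [map_div₀, ← map_map_eq_of_unramifiedAbove hp h ι σ τ hyL, div_pow] at h1
    rw [map_div₀, map_pow]
    have hσY0 : σ Y ≠ 0 := by simpa using hY0
    have hστY0 : σ (τ Y) ≠ 0 := by simpa using hY0
    rw [div_eq_div_iff hτY0 (pow_ne_zero _ hY0)] at h1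
    rw [div_eq_div_iff hστY0 hτY0, ← h1, mul_comm]
  obtain ⟨z, hz⟩ := IntermediateField.mem_bot.1 ((InfiniteGalois.mem_bot_iff_fixed _).2 hfix)
  have hzn : z ^ p ^ n = (a₁ : q.adicCompletion F) ^ c := by
    refine (FaithfulSMul.algebraMap_injective (q.adicCompletion F)
      (AlgebraicClosure (q.adicCompletion F))) ?_
    rw [map_pow, hz, div_pow, ← map_pow τ, hY, τ.commutes, ← pow_mul, mul_comm, pow_mul, hY,
      map_pow, pow_succ, mul_div_cancel_right₀]
    rw [← hY]
    exact pow_ne_zero _ hY0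
  have hz0 : z ≠ 0 := by
    rintro rfl
    rw [zero_pow (pow_ne_zero n hp.ne_zero)] at hzn
    exact pow_ne_zero c a₁.ne_zero hzn.symm
  exact exists_pow_eq_pow_of_gcd_dvd (c := Units.mk0 z hz0) (m := c)
    (Units.ext (by push_cast; exact hzn.symm)) hgcd

end LocalPrime

end KummerZp

end

open IsDedekindDomain NumberField KummerZp in
theorem mainTheorem10 (p : ℕ) [Fact p.Prime] (F : Type*) [Field F] [NumberField F] :
    -- the ramification criterion at a prime `q`
    (∀ x : PCompletion p Fˣ, ¬ IsOfFinAddOrder x → ∀ q : HeightOneSpectrum (𝓞 F),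
      (UnramifiedAbove (cyclotomicTower p F) (kummerExtension p x) q ↔
        IsOfFinAddOrder (loc p q x))) ∧
    (∀ Q : Finset (HeightOneSpectrum (𝓞 F)), ∀ x : PCompletion p Fˣ,
      -- a)
      (x ∈ completedQUnits p Q ↔ ∀ q ∉ Q, completedVal p q x = 0) ∧
      -- b)
      (¬ IsOfFinAddOrder x →
        ((∀ q ∉ Q, UnramifiedAbove (cyclotomicTower p F) (kummerExtension p x) q) →
          x ∈ completedQUnits p Q) ∧
        ((∀ q : HeightOneSpectrum (𝓞 F), (p : 𝓞 F) ∈ q.asIdeal → q ∈ Q) →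
          x ∈ completedQUnits p Q →
          ∀ q ∉ Q, UnramifiedAbove (cyclotomicTower p F) (kummerExtension p x) q))) := by
  refine ⟨fun x _ q => ⟨isOfFinAddOrder_loc_of_unramifiedAbove,
    unramifiedAbove_of_isOfFinAddOrder⟩, fun Q x => ⟨mem_completedQUnits_iff, fun _ =>
    ⟨fun h => mem_completedQUnits_iff.2 fun q hq => ?_, fun hQ hx q hq =>
      unramifiedAbove_of_mem_completedQUnits hx hq fun hpq => hq (hQ q hpq)⟩⟩⟩
  obtain ⟨m, hm, h0⟩ := isOfFinAddOrder_iff_nsmul_eq_zero.1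
    (isOfFinAddOrder_loc_of_unramifiedAbove (h q hq))
  -- The valuation of a torsion element is torsion in `ℤ_p`, hence zero.
  have h1 := congrArg (PCompletion.extend p (localVal q)) h0
  rw [map_nsmul, map_zero] at h1
  exact (smul_eq_zero.1 h1).resolve_left hm.ne'
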